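/- Let $n_t,n_r\ge 1$ be integers and let $\mathbf H$ be a random $n_r\times n_t$ complex matrix whose entries are i.i.d. $\mathcal{CN}(0,1)$ (circularly symmetric complex Gaussian with mean $0$ and variance $1$). For a Hermitian positive semidefinite $n_t\times n_t$ matrix $\mathbf Q$ (the transmit covariance matrix) let $$\mathcal I(\mathbf Q)=\ln\det\left(\mathbf I_{n_t}+\mathbf Q\mathbf H^\dagger\mathbf H\right),\qquad \tilde{\mathcal I}(\mathbf Q)=\ln\left(1+\operatorname{tr}(\mathbf Q\mathbf H^\dagger\mathbf H)\right)$$ be the instantaneous mutual information of the MIMO channel and its low-SNR approximation. For a rate $R\in\mathbb R$ the throughput is $\Pr\{\mathcal I(\mathbf Q)\ge R\}\,R$, respectively $\Pr\{\tilde{\mathcal I}(\mathbf Q)\ge R\}\,R$. Let $\Gamma(a,x)=\int_x^\infty t^{a-1}e^{-t}\,dt$. (a) (Low-SNR form of the mutual information.) For every $P>0$, the maximum of $\Pr\{\tilde{\mathcal I}(\mathbf Q)\ge R\}\,R$ over all $R$ and all $\mathbf Q$ with $\operatorname{tr}(\mathbf Q)\le P$ exists and equals $$\tilde{\mathcal R}(P)=\max_{0<s<n_r}\frac{\Gamma(n_tn_r,\,n_ts)}{(n_tn_r-1)!}\,\ln(1+Ps),$$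 where the maximum over the open interval is attained. It is achieved by equal power independent signals on all antennas: $\mathbf Q^o=\frac{P}{n_t}\mathbf I_{n_t}$ is admissible and $\max_R \Pr\{\tilde{\mathcal I}(\mathbf Q^o)\ge R\}\,R=\tilde{\mathcal R}(P)$. (b) (Low-SNR asymptotics of the exact channel.) For every $P>0$ the supremum $\mathcal R_s^m(P)$ of $\Pr\{\mathcal I(\mathbf Q)\ge R\}\,R$ over all $R$ and all $\mathbf Q$ with $\operatorname{tr}(\mathbf Q)\le P$ is finite, and as $P\to0^+$ one has $\mathcal R_s^m(P)\sim\tilde{\mathcal R}(P)$ and $\sup_R \Pr\{\mathcal I(\frac{P}{n_t}\mathbf I_{n_t})\ge R\}\,R\sim\mathcal R_s^m(P)$, where $\sim$ means that the ratio tends to $1$. -/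

import Mathlib

open MeasureTheory ProbabilityTheory Filter Topology
open scoped Matrix NNReal Asymptotics ComplexOrder

noncomputable section

namespace MIMO

/-- The circularly symmetric complex Gaussian law `CN(0,1)`: independent real and imaginary parts,
each with law `N(0,1/2)`. -/
def stdComplexGaussian : Measure ℂ :=
  ((gaussianReal 0 (1 / 2)).prod (gaussianReal 0 (1 / 2))).map
    (fun p : ℝ × ℝ => (⟨p.1, p.2⟩ : ℂ))

/-- `H` is an i.i.d. Rayleigh fading channel matrix (`nr` receive and `nt` transmit antennas):
its entries are independent and each has law `CN(0,1)`. -/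
structure IsRayleigh {nt nr : ℕ} {Ω : Type*} [MeasurableSpace Ω] (μ : Measure Ω)
    (H : Ω → Matrix (Fin nr) (Fin nt) ℂ) : Prop where
  hasLaw : ∀ k l, HasLaw (fun ω => H ω k l) stdComplexGaussian μ
  indep : iIndepFun (fun (p : Fin nr × Fin nt) ω => H ω p.1 p.2) μ

/-- The admissible transmit covariance matrices under the total power constraint `P`. -/
def admissible (nt : ℕ) (P : ℝ) : Set (Matrix (Fin nt) (Fin nt) ℂ) :=
  {Q | Q.PosSemidef ∧ Q.trace.re ≤ P}

/-- Equal power independent signals on all transmit antennas: `(P / nt) I`. -/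
def equalPower (nt : ℕ) (P : ℝ) : Matrix (Fin nt) (Fin nt) ℂ :=
  ((P / nt : ℝ) : ℂ) • (1 : Matrix (Fin nt) (Fin nt) ℂ)

/-- The instantaneous mutual information `ln det (I + Q H† H)` (the determinant is a real number,
at least `1`, for positive semidefinite `Q`). -/
def mutualInfo {nt nr : ℕ} (Q : Matrix (Fin nt) (Fin nt) ℂ) (H : Matrix (Fin nr) (Fin nt) ℂ) : ℝ :=
  Real.log (1 + Q * (Hᴴ * H)).det.re

/-- The low-SNR form `ln (1 + tr (Q H† H))` of the instantaneous mutual information (the trace is a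
nonnegative real number for positive semidefinite `Q`). -/
def lowSNRInfo {nt nr : ℕ} (Q : Matrix (Fin nt) (Fin nt) ℂ) (H : Matrix (Fin nr) (Fin nt) ℂ) : ℝ :=
  Real.log (1 + (Q * (Hᴴ * H)).trace.re)

variable {nt nr : ℕ} {Ω : Type*} [MeasurableSpace Ω]

/-- The throughput `Pr {I ≥ R} R` of a single-layer code of rate `R` with transmit covariance matrix
`Q`, where the instantaneous mutual information is `info Q H`. -/
def throughput (info : Matrix (Fin nt) (Fin nt) ℂ → Matrix (Fin nr) (Fin nt) ℂ → ℝ)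
    (μ : Measure Ω) (H : Ω → Matrix (Fin nr) (Fin nt) ℂ)
    (Q : Matrix (Fin nt) (Fin nt) ℂ) (R : ℝ) : ℝ :=
  μ.real {ω | R ≤ info Q (H ω)} * R

/-- All throughputs that arise, over all rates, from the fixed covariance matrix `Q`. -/
def throughputsAt (info : Matrix (Fin nt) (Fin nt) ℂ → Matrix (Fin nr) (Fin nt) ℂ → ℝ)
    (μ : Measure Ω) (H : Ω → Matrix (Fin nr) (Fin nt) ℂ)
    (Q : Matrix (Fin nt) (Fin nt) ℂ) : Set ℝ :=
  Set.range (throughput info μ H Q)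

/-- All throughputs that arise, over all rates and all covariance matrices admissible for the total
power `P`. The maximum throughput is the greatest element of this set. -/
def throughputs (info : Matrix (Fin nt) (Fin nt) ℂ → Matrix (Fin nr) (Fin nt) ℂ → ℝ)
    (μ : Measure Ω) (H : Ω → Matrix (Fin nr) (Fin nt) ℂ) (P : ℝ) : Set ℝ :=
  {x | ∃ Q ∈ admissible nt P, ∃ R : ℝ, x = throughput info μ H Q R}

/-- The upper incomplete gamma function. -/
def upperGamma (a x : ℝ) : ℝ := ∫ t in Set.Ioi x, t ^ (a - 1) * Real.exp (-t)

/-- `Γ(nt nr, nt s) / (nt nr - 1)! * ln (1 + P s)`. -/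
def rateFormula (nt nr : ℕ) (P s : ℝ) : ℝ :=
  upperGamma ((nt * nr : ℕ) : ℝ) (nt * s) / (Nat.factorial (nt * nr - 1) : ℝ) * Real.log (1 + P * s)

end MIMO

end

/-! By unitary invariance of the Gaussian matrix, `tr (Q H† H)` is a sum of independent standard
exponentials weighted by the eigenvalues of `Q`, each repeated `nr` times. Divided by `P nr`, it
becomes `W = ∑ aᵢ yᵢ` with `aᵢ ≥ 0` and `∑ aᵢ ≤ 1`. Let `F` be the tail of `W` for equal weights of
sum `1`. Two tail estimates carry everything. (1) For `0 < s ≤ 1`, `P(W ≥ s) ≤ F(s)`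
(`expTail_le_uniform`). (2) For `s ≥ 1`, `s P(W ≥ s) ≤ F(1)` (`mul_expTail_le_uniform`).

Both rest on the density `f` of `W` for positive weights: it is log-concave and satisfies `x f = ∑
aᵢ fᵢ`, where `fᵢ` is `f` convolved with the exponential law of mean `aᵢ` (size biasing,
`exists_density_sum`). Log-concavity makes the sign of `fᵢ - f` change at most once as `aᵢ` grows
(`IsLogConcave.exists_crossing`). For (1), move the weights linearly to equality: the derivative of
`E g(W)` is an integral of `g'` against `∑ (1/n - aᵢ) fᵢ`, which is nonnegative below the mean. For
(2), the same identity gives `x f' ≤ -f` above the mean, hence `∫ₓ^∞ f ≤ x f(x)`, so that `x P(W ≥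
x)` decreases.

Since `log (1 + c s) / s` decreases, (1) and (2) bound every low-SNR throughput by some `F(t) log (1
+ P nr t)` with `0 < t ≤ 1`, a value attained by equal power. For the exact channel, `log (1 + tr) ≤
log det ≤ tr` puts both suprema between `Rmax P` and `P nr max t F(t)`, which are equivalent as `P →
0`. -/

noncomputable section

namespace MIMO

open scoped ENNReal

/-! ### Algebra of convolution with exponential densities. -/

/-- Convolution on `[0, ∞)` with the density of an exponential variable of mean `a`; equivalently,
the solution of `a u' + u = f`, `u 0 = 0`. -/
def expConv (a : ℝ) (f : ℝ → ℝ) (x : ℝ) : ℝ :=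
  Real.exp (-x / a) / a * ∫ y in (0 : ℝ)..x, f y * Real.exp (y / a)

@[simp] lemma expConv_zero (a : ℝ) (f : ℝ → ℝ) : expConv a f 0 = 0 := by simp [expConv]

lemma hasDerivAt_expConv {a : ℝ} {f : ℝ → ℝ} (hf : Continuous f) (x : ℝ) :
    HasDerivAt (expConv a f) ((f x - expConv a f x) / a) x := by
  have hc : Continuous fun y => f y * Real.exp (y / a) := by fun_prop
  have h1 : HasDerivAt (fun x => ∫ y in (0 : ℝ)..x, f y * Real.exp (y / a))
      (f x * Real.exp (x / a)) x :=
    intervalIntegral.integral_hasDerivAt_right (hc.intervalIntegrable _ _)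
      (hc.stronglyMeasurableAtFilter _ _) hc.continuousAt
  have h2 : HasDerivAt (fun x => Real.exp (-x / a) / a)
      (Real.exp (-x / a) * (-1 / a) / a) x :=
    (((hasDerivAt_id x).neg.div_const a).exp).div_const a
  have h := h2.mul h1
  have e : Real.exp (-x / a) * Real.exp (x / a) = 1 := by
    rw [← Real.exp_add]; simp [neg_div]
  refine h.congr_deriv ?_
  simp only [expConv]
  set I := ∫ y in (0 : ℝ)..x, f y * Real.exp (y / a)
  have e' : Real.exp (-x / a) * (-1 / a) / a * I + Real.exp (-x / a) / a * (f x * Real.exp (x / a))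
      = Real.exp (-x / a) * (-1 / a) / a * I
        + (Real.exp (-x / a) * Real.exp (x / a)) * f x / a := by ring
  rw [e', e]
  ring

lemma continuous_expConv {a : ℝ} {f : ℝ → ℝ} (hf : Continuous f) :
    Continuous (expConv a f) :=
  continuous_iff_continuousAt.2 fun x => (hasDerivAt_expConv hf x).continuousAt

/-- The factor `exp (x / a)` makes the difference of two solutions constant. This uniqueness reduces
most closed forms and identities below to a differentiation. -/
lemma eq_expConv {a : ℝ} (ha : a ≠ 0) {f u : ℝ → ℝ} (hf : Continuous f) (h0 : u 0 = 0)
    (hu : ∀ x, HasDerivAt u ((f x - u x) / a) x) : u = expConv a f := by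
  have hd : ∀ x, HasDerivAt (fun x => Real.exp (x / a) * (u x - expConv a f x)) 0 x := by
    intro x
    have h := (((hasDerivAt_id x).div_const a).exp).mul ((hu x).sub (hasDerivAt_expConv (a := a) hf x))
    refine h.congr_deriv ?_
    simp
    field_simp
    ring
  have hc := is_const_of_deriv_eq_zero (fun x => (hd x).differentiableAt) (fun x => (hd x).deriv)
  funext x
  have := hc x 0
  simp [h0] at this
  linarith

/-- With `D = d/dx` and zero initial value, `expConv a` is `(1 + a D)⁻¹`; this is its resolvent
identity, the means of comparing two parameters. -/
lemma expConv_resolvent {a b : ℝ} (ha : a ≠ 0) (hb : b ≠ 0) {f : ℝ → ℝ} (hf : Continuous f)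
    (x : ℝ) :
    b * expConv b f x = a * expConv a f x + (b - a) * expConv b (expConv a f) x := by
  have hU := continuous_expConv (a := a) hf
  have key : (fun x => b * expConv b f x - a * expConv a f x
      - (b - a) * expConv b (expConv a f) x) = expConv b (fun _ => 0) := by
    refine eq_expConv hb continuous_const (by simp) fun x => ?_
    have h := (((hasDerivAt_expConv (a := b) hf x).const_mul b).sub
      ((hasDerivAt_expConv (a := a) hf x).const_mul a)).sub
      ((hasDerivAt_expConv (a := b) hU x).const_mul (b - a))
    refine h.congr_deriv ?_
    field_simp
    ring
  have := congrFun key x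
  simp [expConv] at this
  simp only [expConv]
  linarith

lemma expConv_comm {a b : ℝ} (ha : a ≠ 0) (hb : b ≠ 0) {f : ℝ → ℝ} (hf : Continuous f) (x : ℝ) :
    expConv a (expConv b f) x = expConv b (expConv a f) x := by
  rcases eq_or_ne a b with rfl | hab
  · rfl
  · have h1 := expConv_resolvent ha hb hf x
    have h2 := expConv_resolvent hb ha hf x
    have : (b - a) * (expConv a (expConv b f) x - expConv b (expConv a f) x) = 0 := by
      linear_combination h1 + h2
    rcases mul_eq_zero.1 this with h | h
    · exact absurd (by linarith) hab
    · linarith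

lemma expConv_congr {a x : ℝ} {f g : ℝ → ℝ} (hx : 0 ≤ x) (h : ∀ y, 0 < y → f y = g y) :
    expConv a f x = expConv a g x := by
  unfold expConv
  congr 1
  refine intervalIntegral.integral_congr_ae ?_
  filter_upwards with y hy
  rw [Set.uIoc_of_le hx] at hy
  rw [h y hy.1]

lemma expConv_sum {ι : Type*} (s : Finset ι) (a : ℝ) (c : ι → ℝ) {f : ι → ℝ → ℝ}
    (hf : ∀ i ∈ s, Continuous (f i)) (x : ℝ) :
    expConv a (fun y => ∑ i ∈ s, c i * f i y) x = ∑ i ∈ s, c i * expConv a (f i) x := by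
  simp only [expConv]
  have : ∀ y, (∑ i ∈ s, c i * f i y) * Real.exp (y / a)
      = ∑ i ∈ s, c i * (f i y * Real.exp (y / a)) := fun y => by
    rw [Finset.sum_mul]; exact Finset.sum_congr rfl fun i _ => by ring
  simp_rw [this]
  rw [intervalIntegral.integral_finsetSum]
  · rw [Finset.mul_sum]
    refine Finset.sum_congr rfl fun i _ => ?_
    rw [intervalIntegral.integral_const_mul]; ring
  · intro i hi
    have := hf i hi
    exact Continuous.intervalIntegrable (by fun_prop) _ _

/-- Multiplication by `x` and `1 + a D` have commutator `a`, whence the correction term. -/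
lemma expConv_id_mul {a : ℝ} (ha : a ≠ 0) {f : ℝ → ℝ} (hf : Continuous f) (x : ℝ) :
    expConv a (fun y => y * f y) x = x * expConv a f x - a * expConv a (expConv a f) x := by
  have hU := continuous_expConv (a := a) hf
  refine (congrFun (eq_expConv (u := fun x => x * expConv a f x - a * expConv a (expConv a f) x)
    ha (by fun_prop) (by simp) fun x => ?_) x).symm
  have h := ((hasDerivAt_id x).mul (hasDerivAt_expConv (a := a) hf x)).sub
    ((hasDerivAt_expConv (a := a) hU x).const_mul a)
  refine h.congr_deriv ?_
  simp
  field_simp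
  ring

lemma expConv_eq_integral (a : ℝ) (f : ℝ → ℝ) (x : ℝ) :
    expConv a f x = ∫ y in (0 : ℝ)..x, f y * (Real.exp (-(x - y) / a) / a) := by
  rw [expConv, ← intervalIntegral.integral_const_mul]
  congr 1
  funext y
  have : Real.exp (-(x - y) / a) = Real.exp (-x / a) * Real.exp (y / a) := by
    rw [← Real.exp_add]; ring_nf
  rw [this]; ring

lemma expConv_eq_integral_sub (a : ℝ) (f : ℝ → ℝ) (x : ℝ) :
    expConv a f x = ∫ y in (0 : ℝ)..x, f (x - y) * (Real.exp (-y / a) / a) := by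
  rw [expConv_eq_integral]
  have := intervalIntegral.integral_comp_sub_left (a := 0) (b := x)
    (fun y => f y * (Real.exp (-(x - y) / a) / a)) x
  simp only [sub_sub_cancel, sub_self, sub_zero] at this
  exact this.symm

lemma expConv_one {a : ℝ} (ha : a ≠ 0) (x : ℝ) :
    expConv a (fun _ => 1) x = 1 - Real.exp (-x / a) := by
  refine (congrFun (eq_expConv (u := fun x => 1 - Real.exp (-x / a))
    ha (by fun_prop) (by simp) fun x => ?_) x).symm
  have h := (((hasDerivAt_id x).neg.div_const a).exp).const_sub 1
  refine h.congr_deriv ?_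
  simp
  field_simp

lemma expConv_mono {a x : ℝ} (ha : 0 < a) (hx : 0 ≤ x) {f g : ℝ → ℝ} (hf : Continuous f)
    (hg : Continuous g) (h : ∀ y ∈ Set.Icc 0 x, f y ≤ g y) : expConv a f x ≤ expConv a g x := by
  unfold expConv
  refine mul_le_mul_of_nonneg_left ?_ (by positivity)
  refine intervalIntegral.integral_mono_on hx (Continuous.intervalIntegrable (by fun_prop) _ _)
    (Continuous.intervalIntegrable (by fun_prop) _ _) fun y hy => ?_
  exact mul_le_mul_of_nonneg_right (h y hy) (by positivity)

lemma expConv_const_mul (a c : ℝ) (f : ℝ → ℝ) (x : ℝ) :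
    expConv a (fun y => c * f y) x = c * expConv a f x := by
  simp only [expConv, mul_assoc, intervalIntegral.integral_const_mul]; ring

lemma expConv_le_of_le {a x c : ℝ} (ha : 0 < a) (hx : 0 ≤ x) (hc : 0 ≤ c) {f : ℝ → ℝ}
    (hf : Continuous f) (h : ∀ y ∈ Set.Icc 0 x, f y ≤ c) : expConv a f x ≤ c := by
  have h1 := expConv_mono (g := fun _ => c * 1) ha hx hf (by fun_prop) (by simpa using h)
  rw [expConv_const_mul a c (fun _ => 1), expConv_one ha.ne'] at h1
  nlinarith [Real.exp_pos (-x / a)]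

/-! ### Log-concave functions and their exponential convolutions. -/

/-- A continuous function that is positive and log-concave on `(0, ∞)`. -/
structure IsLogConcave (f : ℝ → ℝ) : Prop where
  continuous : Continuous f
  pos : ∀ x, 0 < x → 0 < f x
  -- The ratio `f (x + h) / f x` is nonincreasing in `x`, with denominators cleared.
  le : ∀ x x' h, 0 < x → x ≤ x' → 0 ≤ h → f (x' + h) * f x ≤ f (x + h) * f x'

lemma IsLogConcave.expConv_pos {f : ℝ → ℝ} (hf : IsLogConcave f) {a x : ℝ} (ha : 0 < a)
    (hx : 0 < x) : 0 < expConv a f x := by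
  unfold expConv
  refine mul_pos (by positivity) ?_
  have := hf.continuous
  refine intervalIntegral.intervalIntegral_pos_of_pos_on
    (Continuous.intervalIntegrable (by fun_prop) _ _) (fun y hy => ?_) hx
  exact mul_pos (hf.pos y hy.1) (Real.exp_pos _)

/-- The ratio of a log-concave `f` to `expConv a f` is nonincreasing. -/
lemma IsLogConcave.expConv_mul_le {f : ℝ → ℝ} (hf : IsLogConcave f) {a x x' : ℝ} (ha : 0 < a)
    (hx : 0 < x) (hxx : x ≤ x') : expConv a f x * f x' ≤ expConv a f x' * f x := by
  have hc := hf.continuous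
  have hint : ∀ u v w : ℝ, IntervalIntegrable
      (fun y => f (w - y) * (Real.exp (-y / a) / a)) volume u v := fun u v w =>
    Continuous.intervalIntegrable (by fun_prop) _ _
  rw [expConv_eq_integral_sub, expConv_eq_integral_sub]
  -- On `(0, x)` the integrands compare pointwise, by log-concavity at `x - y ≤ x' - y` with shift
  -- `y`; the remaining interval `(x, x')` only adds a nonnegative amount.
  have h1 : (∫ y in (0 : ℝ)..x, f (x - y) * (Real.exp (-y / a) / a)) * f x'
      ≤ (∫ y in (0 : ℝ)..x, f (x' - y) * (Real.exp (-y / a) / a)) * f x := by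
    rw [← intervalIntegral.integral_mul_const, ← intervalIntegral.integral_mul_const]
    refine intervalIntegral.integral_mono_on_of_le_Ioo hx.le ((hint _ _ _).mul_const _)
      ((hint _ _ _).mul_const _) fun y hy => ?_
    have := hf.le (x - y) (x' - y) y (by linarith [hy.2]) (by linarith) hy.1.le
    simp only [sub_add_cancel] at this
    have hk : 0 ≤ Real.exp (-y / a) / a := by positivity
    nlinarith
  have h2 : (∫ y in (0 : ℝ)..x, f (x' - y) * (Real.exp (-y / a) / a))
      ≤ ∫ y in (0 : ℝ)..x', f (x' - y) * (Real.exp (-y / a) / a) := by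
    rw [← intervalIntegral.integral_add_adjacent_intervals (hint 0 x x') (hint x x' x')]
    have : 0 ≤ ∫ y in x..x', f (x' - y) * (Real.exp (-y / a) / a) := by
      rw [intervalIntegral.integral_of_le hxx, integral_Ioc_eq_integral_Ioo]
      refine setIntegral_nonneg measurableSet_Ioo fun y hy => ?_
      exact mul_nonneg (hf.pos _ (by linarith [hy.2])).le (by positivity)
    linarith
  exact h1.trans (mul_le_mul_of_nonneg_right h2 (hf.pos x hx).le)

/-- With `U = expConv a f`, the logarithmic derivative of `U (x + h) / U x` is `1 / a` times the
increment of `f / U` from `x` to `x + h`, which is nonpositive by `IsLogConcave.expConv_mul_le`. -/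
lemma IsLogConcave.expConv {f : ℝ → ℝ} (hf : IsLogConcave f) {a : ℝ} (ha : 0 < a) :
    IsLogConcave (expConv a f) where
  continuous := continuous_expConv hf.continuous
  pos x hx := hf.expConv_pos ha hx
  le x x' h hx hxx hh := by
    set U := MIMO.expConv a f with hU
    have hUp : ∀ x, 0 < x → 0 < U x := fun x hx => hf.expConv_pos ha hx
    have hd : ∀ x, HasDerivAt U ((f x - U x) / a) x := hasDerivAt_expConv hf.continuous
    have hq : ∀ x, 0 < x → HasDerivAt (fun x => U (x + h) / U x)
        (((f (x + h) - U (x + h)) / a * U x - U (x + h) * ((f x - U x) / a)) / U x ^ 2) x :=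
      fun x hx => ((hd (x + h)).comp_add_const x h).div (hd x) (hUp x hx).ne'
    have hanti : AntitoneOn (fun x => U (x + h) / U x) (Set.Ioi 0) := by
      refine antitoneOn_of_deriv_nonpos (convex_Ioi 0)
        (fun x hx => (hq x hx).continuousAt.continuousWithinAt) ?_ ?_
      · intro x hx
        rw [interior_Ioi] at hx
        exact (hq x hx).differentiableAt.differentiableWithinAt
      · intro x hx
        rw [interior_Ioi] at hx
        rw [(hq x hx).deriv]
        have := hf.expConv_mul_le ha hx (show x ≤ x + h by linarith)
        refine div_nonpos_of_nonpos_of_nonneg ?_ (by positivity)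
        have e : (f (x + h) - U (x + h)) / a * U x - U (x + h) * ((f x - U x) / a)
          = (U x * f (x + h) - U (x + h) * f x) / a := by ring
        rw [e]
        exact div_nonpos_of_nonpos_of_nonneg (by linarith) ha.le
    have := hanti (Set.mem_Ioi.2 hx) (Set.mem_Ioi.2 (hx.trans_le hxx)) hxx
    simp only at this
    rwa [div_le_div_iff₀ (hUp _ (hx.trans_le hxx)) (hUp _ hx)] at this

lemma isLogConcave_exp {a : ℝ} (ha : 0 < a) : IsLogConcave fun x => Real.exp (-x / a) / a where
  continuous := by fun_prop
  pos x _ := by positivity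
  le x x' h _ _ _ := by
    have : ∀ u v : ℝ, Real.exp (-u / a) / a * (Real.exp (-v / a) / a)
        = Real.exp (-(u + v) / a) / a ^ 2 := fun u v => by
      rw [div_mul_div_comm, ← Real.exp_add]; ring_nf
    rw [this, this]
    apply le_of_eq; ring_nf

/-- Below the mode of `expConv a f`, the function `b ↦ expConv b f x` is nonincreasing on
`[a, ∞)`. -/
lemma IsLogConcave.expConv_le_expConv {f : ℝ → ℝ} (hf : IsLogConcave f) {a b x : ℝ} (ha : 0 < a)
    (hab : a ≤ b) (hx : 0 < x) (h : MIMO.expConv a f x ≤ f x) :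
    MIMO.expConv b f x ≤ MIMO.expConv a f x := by
  have hb : 0 < b := ha.trans_le hab
  set U := MIMO.expConv a f with hU
  have hUp : ∀ x, 0 < x → 0 < U x := fun x hx => hf.expConv_pos ha hx
  have hd : ∀ x, HasDerivAt U ((f x - U x) / a) x := hasDerivAt_expConv hf.continuous
  -- As `f / U` is nonincreasing and at least `1` at `x`, it is at least `1` before `x`, so `U' = (f
  -- - U) / a ≥ 0` there.
  have hmono : MonotoneOn U (Set.Icc 0 x) := by
    refine monotoneOn_of_deriv_nonneg (convex_Icc 0 x)
      (fun x _ => (hd x).continuousAt.continuousWithinAt)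
      (fun x _ => (hd x).differentiableAt.differentiableWithinAt) fun y hy => ?_
    rw [interior_Icc] at hy
    rw [(hd y).deriv]
    refine div_nonneg ?_ ha.le
    have h1 := hf.expConv_mul_le ha hy.1 hy.2.le
    have h2 : MIMO.expConv a f x * f y ≤ f x * f y :=
      mul_le_mul_of_nonneg_right h (hf.pos y hy.1).le
    have := le_of_mul_le_mul_right (h1.trans (h2.trans_eq (mul_comm _ _))) (hf.pos x hx)
    linarith
  -- The kernel of `expConv b` has mass at most `1` on `[0, x]`, where `U ≤ U x`. The resolvent
  -- identity then writes `b * expConv b f x` as `a U + (b - a) expConv b U ≤ b U`.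
  have h3 : MIMO.expConv b U x ≤ U x :=
    expConv_le_of_le hb hx.le (hUp x hx).le (continuous_expConv hf.continuous)
      fun y hy => hmono hy ⟨hx.le, le_rfl⟩ hy.2
  have h4 := expConv_resolvent ha.ne' hb.ne' hf.continuous x
  rw [← hU] at h4
  have : b * MIMO.expConv b f x ≤ b * U x := by
    rw [h4]; nlinarith
  exact le_of_mul_le_mul_left this hb

section Weights

variable {ι : Type*} {s : Finset ι} {a : ι → ℝ} {f : ℝ → ℝ} {x : ℝ}

/-- The signs of `expConv (a i) f x - f x` change at most once as `a i` grows. -/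
lemma IsLogConcave.exists_crossing (hf : IsLogConcave f) (ha : ∀ i ∈ s, 0 < a i) (hx : 0 < x)
    (hneg : ∃ i ∈ s, MIMO.expConv (a i) f x - f x < 0) :
    ∃ j ∈ s, MIMO.expConv (a j) f x - f x < 0 ∧
      ∑ i ∈ s, a i * (MIMO.expConv (a i) f x - f x)
        ≤ a j * ∑ i ∈ s, (MIMO.expConv (a i) f x - f x) := by
  classical
  obtain ⟨i₀, hi₀, hi₀'⟩ := hneg
  -- Take the smallest weight with a negative difference. No larger weight can have a nonnegative
  -- one, so each `(a i - a j) * (expConv (a i) f x - f x)` is nonpositive.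
  obtain ⟨j, hj, hmin⟩ := Finset.exists_min_image
    (s.filter fun i => MIMO.expConv (a i) f x - f x < 0) a
    ⟨i₀, Finset.mem_filter.2 ⟨hi₀, hi₀'⟩⟩
  obtain ⟨hjs, hj'⟩ := Finset.mem_filter.1 hj
  refine ⟨j, hjs, hj', ?_⟩
  rw [Finset.mul_sum]
  refine Finset.sum_le_sum fun i hi => ?_
  rcases lt_or_ge (MIMO.expConv (a i) f x - f x) 0 with h | h
  · exact mul_le_mul_of_nonpos_right (hmin i (Finset.mem_filter.2 ⟨hi, h⟩)) h.le
  · refine mul_le_mul_of_nonneg_right (le_of_not_gt fun hlt => ?_) h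
    have := hf.expConv_le_expConv (ha j hjs) hlt.le hx (by linarith)
    linarith

lemma sum_mul_expConv_sub (hsum : x * f x = ∑ i ∈ s, a i * expConv (a i) f x) :
    ∑ i ∈ s, a i * (expConv (a i) f x - f x) = (x - ∑ i ∈ s, a i) * f x := by
  simp only [mul_sub, Finset.sum_sub_distrib, ← Finset.sum_mul, sub_mul, hsum]

/-- Above the mean the sum weighted by `a i` equals `(x - ∑ a i) f x ≥ 0`, and the single crossing
transfers this sign to the unweighted sum. It will yield `x f' ≤ -f`. -/
lemma IsLogConcave.sum_expConv_sub_nonneg (hf : IsLogConcave f) (ha : ∀ i ∈ s, 0 < a i)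
    (hx : 0 < x) (hsx : ∑ i ∈ s, a i ≤ x)
    (hsum : x * f x = ∑ i ∈ s, a i * MIMO.expConv (a i) f x) :
    0 ≤ ∑ i ∈ s, (MIMO.expConv (a i) f x - f x) := by
  by_cases hneg : ∃ i ∈ s, MIMO.expConv (a i) f x - f x < 0
  · obtain ⟨j, hj, -, hle⟩ := hf.exists_crossing ha hx hneg
    rw [sum_mul_expConv_sub hsum] at hle
    have : 0 ≤ (x - ∑ i ∈ s, a i) * f x := mul_nonneg (by linarith) (hf.pos x hx).le
    exact nonneg_of_mul_nonneg_right (this.trans hle) (ha j hj)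
  · push Not at hneg
    exact Finset.sum_nonneg hneg

/-- This is the sign, below the mean, of the derivative in the direction that equalizes the weights.
The coefficients sum to zero, so any constant may be subtracted from the `expConv (a i) f x`; the
choice depends on which side of `f x` the value for the average weight lies. -/
lemma IsLogConcave.sum_sub_mul_expConv_nonneg (hf : IsLogConcave f) (ha : ∀ i ∈ s, 0 < a i)
    (hs : s.Nonempty) (hx : 0 < x) (hx1 : x ≤ 1) (hs1 : ∑ i ∈ s, a i = 1)
    (hsum : x * f x = ∑ i ∈ s, a i * MIMO.expConv (a i) f x) :
    0 ≤ ∑ i ∈ s, (1 / (s.card : ℝ) - a i) * MIMO.expConv (a i) f x := by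
  have hcard : (0 : ℝ) < s.card := by exact_mod_cast hs.card_pos
  have hn : 0 < 1 / (s.card : ℝ) := by positivity
  have hzero : ∑ i ∈ s, (1 / (s.card : ℝ) - a i) = 0 := by
    rw [Finset.sum_sub_distrib, hs1, Finset.sum_const, nsmul_eq_mul]
    field_simp
    ring
  have hshift : ∀ c, ∑ i ∈ s, (1 / (s.card : ℝ) - a i) * MIMO.expConv (a i) f x
      = ∑ i ∈ s, (1 / (s.card : ℝ) - a i) * (MIMO.expConv (a i) f x - c) := fun c => by
    simp only [mul_sub _ _ c, Finset.sum_sub_distrib, ← Finset.sum_mul, hzero, zero_mul, sub_zero]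
  rcases le_or_gt (MIMO.expConv (1 / (s.card : ℝ)) f x) (f x) with hc | hc
  -- Centred at the value for the average weight, every term is nonnegative by monotonicity in the
  -- weight.
  · rw [hshift (MIMO.expConv (1 / (s.card : ℝ)) f x)]
    refine Finset.sum_nonneg fun i hi => ?_
    rcases le_total (a i) (1 / (s.card : ℝ)) with h | h
    · refine mul_nonneg (by linarith) (sub_nonneg.2 ?_)
      rcases le_total (MIMO.expConv (a i) f x) (f x) with h' | h'
      · exact hf.expConv_le_expConv (ha i hi) h hx h'
      · exact hc.trans h'
    · exact mul_nonneg_of_nonpos_of_nonpos (by linarith)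
        (sub_nonpos.2 (hf.expConv_le_expConv hn h hx hc))
  -- Centred at `f x`, the sum is `S / n + (1 - x) f x` with `S` the unweighted sum of differences.
  -- If `S < 0`, the crossing weight satisfies `a j ≥ 1 / n`, and `(x - 1) f x ≤ a j * S ≤ S / n`.
  · rw [hshift (f x)]
    have hd := sum_mul_expConv_sub hsum
    simp only [sub_mul _ (a _)]
    rw [Finset.sum_sub_distrib, ← Finset.mul_sum, hd, hs1]
    have hd0 : (x - 1) * f x ≤ 0 :=
      mul_nonpos_of_nonpos_of_nonneg (by linarith) (hf.pos x hx).le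
    by_cases hneg : ∃ i ∈ s, MIMO.expConv (a i) f x - f x < 0
    · obtain ⟨j, hj, hj', hle⟩ := hf.exists_crossing ha hx hneg
      rw [hd, hs1] at hle
      have hlt : 1 / (s.card : ℝ) ≤ a j := le_of_not_gt fun hlt => by
        have := hf.expConv_le_expConv (ha j hj) hlt.le hx (by linarith)
        linarith
      set S := ∑ i ∈ s, (MIMO.expConv (a i) f x - f x)
      rcases le_total 0 S with h | h
      · have := mul_nonneg hn.le h
        linarith
      · have := mul_le_mul_of_nonpos_right hlt h
        linarith
    · push Not at hneg
      have := mul_nonneg hn.le (Finset.sum_nonneg hneg)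
      linarith

end Weights

/-! ### Densities on the half-line and laws of sums of exponentials. -/

/-- The measure on `(0, ∞)` with density `f`. -/
def densityMeasure (f : ℝ → ℝ) : Measure ℝ :=
  volume.withDensity ((Set.Ioi 0).indicator fun x => ENNReal.ofReal (f x))

lemma measurable_indicator_ofReal {f : ℝ → ℝ} (hf : Continuous f) :
    Measurable ((Set.Ioi (0 : ℝ)).indicator fun x => ENNReal.ofReal (f x)) :=
  (ENNReal.measurable_ofReal.comp hf.measurable).indicator measurableSet_Ioi

instance (f : ℝ → ℝ) : SFinite (densityMeasure f) := by
  unfold densityMeasure; infer_instance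

lemma densityMeasure_congr {f g : ℝ → ℝ} (h : ∀ x, 0 < x → f x = g x) :
    densityMeasure f = densityMeasure g := by
  unfold densityMeasure
  congr 1
  refine Set.indicator_congr fun x hx => ?_
  rw [h x hx]

lemma densityMeasure_conv_exp {a : ℝ} (ha : 0 < a) {f : ℝ → ℝ} (hf : Continuous f)
    (hpos : ∀ x, 0 < x → 0 ≤ f x) :
    densityMeasure f ∗ densityMeasure (fun x => Real.exp (-x / a) / a)
      = densityMeasure (expConv a f) := by
  unfold densityMeasure
  rw [conv_withDensity_eq_lconvolution (measurable_indicator_ofReal hf)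
    (measurable_indicator_ofReal (by fun_prop))]
  congr 1
  funext x
  rw [lconvolution_def]
  have hprod : ∀ y, (Set.Ioi (0 : ℝ)).indicator (fun x => ENNReal.ofReal (f x)) y *
      (Set.Ioi (0 : ℝ)).indicator (fun x => ENNReal.ofReal (Real.exp (-x / a) / a)) (-y + x)
      = (Set.Ioo 0 x).indicator
        (fun y => ENNReal.ofReal (f y * (Real.exp (-(x - y) / a) / a))) y := by
    intro y
    by_cases h1 : 0 < y
    · by_cases h2 : y < x
      · rw [Set.indicator_of_mem (Set.mem_Ioi.2 h1),
          Set.indicator_of_mem (Set.mem_Ioi.2 (by linarith : 0 < -y + x)),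
          Set.indicator_of_mem (Set.mem_Ioo.2 ⟨h1, h2⟩), ← ENNReal.ofReal_mul (hpos y h1)]
        ring_nf
      · rw [Set.indicator_of_notMem (a := -y + x) (by simp; linarith),
          Set.indicator_of_notMem (s := Set.Ioo 0 x) (by simp [h2]), mul_zero]
    · rw [Set.indicator_of_notMem (s := Set.Ioi 0) (a := y) (by simpa using h1),
        Set.indicator_of_notMem (s := Set.Ioo 0 x) (by simp [h1]), zero_mul]
  simp_rw [hprod]
  rw [lintegral_indicator measurableSet_Ioo]
  by_cases hx : 0 < x
  · rw [Set.indicator_of_mem (Set.mem_Ioi.2 hx), expConv_eq_integral,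
      intervalIntegral.integral_of_le hx.le, integral_Ioc_eq_integral_Ioo,
      ofReal_integral_eq_lintegral_ofReal]
    · have : Continuous fun y => f y * (Real.exp (-(x - y) / a) / a) := by fun_prop
      exact (this.integrableOn_Icc (a := 0) (b := x)).mono_set Set.Ioo_subset_Icc_self
    · filter_upwards [ae_restrict_mem measurableSet_Ioo] with y hy
      exact mul_nonneg (hpos y hy.1) (by positivity)
  · rw [Set.indicator_of_notMem (by simpa using hx), Set.Ioo_eq_empty (by simpa using hx)]
    simp

lemma map_mul_densityMeasure {a : ℝ} (ha : 0 < a) {f : ℝ → ℝ} (hf : Continuous f) :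
    (densityMeasure f).map (fun y => a * y) = densityMeasure (fun x => f (x / a) / a) := by
  have hmeas : Measurable fun y : ℝ => a * y := measurable_const_mul a
  refine Measure.ext_of_lintegral _ fun φ hφ => ?_
  rw [lintegral_map hφ hmeas, densityMeasure, densityMeasure,
    lintegral_withDensity_eq_lintegral_mul _ (measurable_indicator_ofReal hf)
      (g := fun y => φ (a * y)) (hφ.comp hmeas),
    lintegral_withDensity_eq_lintegral_mul _ (measurable_indicator_ofReal (by fun_prop)) hφ]
  have hvol := Real.smul_map_volume_mul_left ha.ne'
  conv_rhs => rw [← hvol]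
  rw [lintegral_smul_measure, lintegral_map _ hmeas, smul_eq_mul, ← lintegral_const_mul]
  · refine lintegral_congr fun y => ?_
    simp only [Pi.mul_apply]
    by_cases hy : 0 < y
    · rw [Set.indicator_of_mem (Set.mem_Ioi.2 hy),
        Set.indicator_of_mem (Set.mem_Ioi.2 (by positivity : 0 < a * y)), abs_of_pos ha,
        ← mul_assoc, ← ENNReal.ofReal_mul ha.le, mul_div_cancel_left₀ _ ha.ne']
      congr 2
      field_simp
    · rw [Set.indicator_of_notMem (by simpa using hy), Set.indicator_of_notMem
        (by simp; nlinarith)]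
      simp
  · exact ((measurable_indicator_ofReal (by fun_prop)).mul hφ).comp hmeas
  · exact (measurable_indicator_ofReal (by fun_prop)).mul hφ

/-- The exponential law of mean `1`. -/
def stdExp : Measure ℝ := densityMeasure fun x => Real.exp (-x)

lemma lintegral_densityMeasure {f : ℝ → ℝ} (hf : Continuous f) {φ : ℝ → ℝ≥0∞}
    (hφ : Measurable φ) :
    ∫⁻ x, φ x ∂densityMeasure f = ∫⁻ x in Set.Ioi 0, ENNReal.ofReal (f x) * φ x := by
  rw [densityMeasure, lintegral_withDensity_eq_lintegral_mul _ (measurable_indicator_ofReal hf) hφ,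
    ← lintegral_indicator measurableSet_Ioi]
  refine lintegral_congr fun x => ?_
  by_cases hx : x ∈ Set.Ioi (0 : ℝ) <;> simp [hx]

instance : IsProbabilityMeasure stdExp where
  measure_univ := by
    rw [← lintegral_one, stdExp, lintegral_densityMeasure (by fun_prop) measurable_const]
    simp only [mul_one]
    rw [← ofReal_integral_eq_lintegral_ofReal, integral_exp_neg_Ioi_zero, ENNReal.ofReal_one]
    · exact integrableOn_exp_neg_Ioi 0
    · filter_upwards with x using (Real.exp_pos _).le

lemma map_mul_stdExp {a : ℝ} (ha : 0 < a) :
    stdExp.map (fun y => a * y) = densityMeasure (fun x => Real.exp (-x / a) / a) := by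
  rw [stdExp, map_mul_densityMeasure ha (by fun_prop)]
  simp only [neg_div]

lemma expConv_exp {a : ℝ} (ha : a ≠ 0) (x : ℝ) :
    expConv a (fun x => Real.exp (-x / a) / a) x = x / a * (Real.exp (-x / a) / a) := by
  refine (congrFun (eq_expConv (u := fun x => x / a * (Real.exp (-x / a) / a))
    ha (by fun_prop) (by simp) fun x => ?_) x).symm
  have h := ((hasDerivAt_id x).div_const a).mul
    ((((hasDerivAt_id x).neg.div_const a).exp).div_const a)
  refine h.congr_deriv ?_
  simp
  field_simp
  ring

lemma ae_pos_stdExp : ∀ᵐ y ∂stdExp, 0 < y := by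
  rw [stdExp, densityMeasure, ae_withDensity_iff (measurable_indicator_ofReal (by fun_prop))]
  filter_upwards with x hx
  by_contra h
  exact hx (Set.indicator_of_notMem h _)

/-- The size-biased exponential law is the law of a sum of two independent exponentials. -/
lemma map_mul_stdExp_withDensity {a : ℝ} (ha : 0 < a) :
    (stdExp.withDensity fun y => ENNReal.ofReal y).map (fun y => a * y)
      = densityMeasure (fun x => Real.exp (-x / a) / a) ∗
        densityMeasure (fun x => Real.exp (-x / a) / a) := by
  rw [densityMeasure_conv_exp ha (by fun_prop) (fun x _ => by positivity)]
  have h1 : (stdExp.withDensity fun y => ENNReal.ofReal y)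
      = densityMeasure fun y => y * Real.exp (-y) := by
    rw [stdExp, densityMeasure, ← withDensity_mul _ (measurable_indicator_ofReal (by fun_prop))
      ENNReal.measurable_ofReal, densityMeasure]
    congr 1
    funext y
    by_cases hy : 0 < y
    · simp only [Pi.mul_apply, Set.indicator_of_mem (Set.mem_Ioi.2 hy)]
      rw [mul_comm, ← ENNReal.ofReal_mul hy.le]
    · simp [Set.indicator_of_notMem (s := Set.Ioi (0 : ℝ)) (a := y) (by simpa using hy)]
  rw [h1, map_mul_densityMeasure ha (by fun_prop)]
  refine densityMeasure_congr fun x _ => ?_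
  rw [expConv_exp ha.ne', neg_div]
  ring

section Sums

variable {ι : Type*} [Fintype ι]

lemma iIndepFun_const_mul_pi (a : ι → ℝ) :
    iIndepFun (fun i (y : ι → ℝ) => a i * y i) (Measure.pi fun _ => stdExp) :=
  iIndepFun_pi (X := fun i y => a i * y) fun i => (measurable_const_mul (a i)).aemeasurable

lemma map_const_mul_eval_pi {a : ι → ℝ} (ha : ∀ i, 0 < a i) (i : ι) :
    (Measure.pi fun _ : ι => stdExp).map (fun y => a i * y i)
      = densityMeasure (fun x => Real.exp (-x / a i) / a i) := by
  have h := Measure.map_map (μ := Measure.pi fun _ : ι => stdExp) (measurable_const_mul (a i))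
    (measurable_pi_apply i)
  rw [(measurePreserving_eval (fun _ : ι => stdExp) i).map_eq, map_mul_stdExp (ha i)] at h
  exact h.symm

lemma map_sum_insert_pi {a : ι → ℝ} (ha : ∀ i, 0 < a i) (s : Finset ι) {i : ι} (hi : i ∉ s) :
    (Measure.pi fun _ : ι => stdExp).map (fun y => a i * y i + ∑ j ∈ s, a j * y j)
      = ((Measure.pi fun _ : ι => stdExp).map fun y => ∑ j ∈ s, a j * y j) ∗
        densityMeasure (fun x => Real.exp (-x / a i) / a i) := by
  have hind := (iIndepFun_const_mul_pi a).indepFun_finsetSum_of_notMem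
    (fun i => by fun_prop) hi
  have e1 : ((∑ j ∈ s, fun y : ι → ℝ => a j * y j) + fun y => a i * y i)
      = fun y => a i * y i + ∑ j ∈ s, a j * y j := by
    funext y; simp [add_comm]
  have e2 : (∑ j ∈ s, fun y : ι → ℝ => a j * y j) = fun y => ∑ j ∈ s, a j * y j := by
    funext y; simp
  have h := hind.map_add_eq_map_conv_map (by rw [e2]; fun_prop) (by fun_prop)
  rw [map_const_mul_eval_pi ha] at h
  rwa [e1, e2] at h

/-- A positive combination of independent exponentials has a log-concave density `f`, which
satisfies `x f = ∑ aᵢ fᵢ` where `fᵢ` is the convolution of `f` with the law of the `i`-th term. -/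
lemma exists_density_sum {a : ι → ℝ} (ha : ∀ i, 0 < a i) {s : Finset ι} (hs : s.Nonempty) :
    ∃ f : ℝ → ℝ, IsLogConcave f ∧
      (∀ x, 0 < x → x * f x = ∑ i ∈ s, a i * expConv (a i) f x) ∧
      (Measure.pi fun _ : ι => stdExp).map (fun y => ∑ i ∈ s, a i * y i) = densityMeasure f := by
  induction hs using Finset.Nonempty.cons_induction with
  | singleton i =>
    refine ⟨fun x => Real.exp (-x / a i) / a i, isLogConcave_exp (ha i), fun x _ => ?_, ?_⟩
    · rw [Finset.sum_singleton, expConv_exp (ha i).ne']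
      have := (ha i).ne'
      field_simp
    · simp only [Finset.sum_singleton]
      exact map_const_mul_eval_pi ha i
  | cons i s hi hs ih =>
    obtain ⟨g, hg, hsum, hlaw⟩ := ih
    refine ⟨expConv (a i) g, hg.expConv (ha i), fun x hx => ?_, ?_⟩
    -- `expConv_id_mul` produces the new term of the sum; inside the other convolution, `y g` is
    -- expanded by induction and the convolutions are commuted.
    · rw [Finset.sum_cons]
      have h1 := expConv_id_mul (ha i).ne' hg.continuous x
      rw [expConv_congr hx.le hsum, expConv_sum _ _ _ fun j _ =>
        continuous_expConv hg.continuous] at h1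
      have h2 : ∑ j ∈ s, a j * expConv (a j) (expConv (a i) g) x
          = ∑ j ∈ s, a j * expConv (a i) (expConv (a j) g) x :=
        Finset.sum_congr rfl fun j _ => by
          rw [expConv_comm (ha j).ne' (ha i).ne' hg.continuous]
      rw [h2, h1]; ring
    · simp only [Finset.sum_cons]
      rw [map_sum_insert_pi ha s hi, hlaw,
        densityMeasure_conv_exp (ha i) hg.continuous fun x hx => (hg.pos x hx).le]

/-- Size-biasing by `y i` replaces `a i * y i` by a sum of two independent copies. The biased law of
the whole sum is therefore its law convolved once more with that exponential. -/
lemma lintegral_ofReal_mul_pi {a : ι → ℝ} (ha : ∀ i, 0 < a i) {f : ℝ → ℝ} (hf : IsLogConcave f)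
    (hlaw : (Measure.pi fun _ : ι => stdExp).map (fun y => ∑ i, a i * y i) = densityMeasure f)
    (i : ι) {φ : ℝ → ℝ≥0∞} (hφ : Measurable φ) :
    ∫⁻ y, ENNReal.ofReal (y i) * φ (∑ j, a j * y j) ∂(Measure.pi fun _ : ι => stdExp)
      = ∫⁻ x in Set.Ioi 0, ENNReal.ofReal (expConv (a i) f x) * φ x := by
  classical
  set π := Measure.pi fun _ : ι => stdExp
  have hi : i ∉ Finset.univ.erase i := Finset.notMem_erase _ _
  have hsplit : ∀ y : ι → ℝ, ∑ j, a j * y j = a i * y i + ∑ j ∈ Finset.univ.erase i, a j * y j :=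
    fun y => (Finset.add_sum_erase _ _ (Finset.mem_univ i)).symm
  have hmi : Measurable fun y : ι → ℝ => y i := measurable_pi_apply i
  have hmR : Measurable fun y : ι → ℝ => ∑ j ∈ Finset.univ.erase i, a j * y j := by fun_prop
  set ρ := π.map fun y => ∑ j ∈ Finset.univ.erase i, a j * y j with hρ
  have : IsProbabilityMeasure ρ := Measure.isProbabilityMeasure_map hmR.aemeasurable
  have hW : densityMeasure f = ρ ∗ densityMeasure (fun x => Real.exp (-x / a i) / a i) := by
    rw [← hlaw, ← map_sum_insert_pi ha _ hi]
    simp_rw [hsplit]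
    rfl
  have hind : (fun y : ι → ℝ => ∑ j ∈ Finset.univ.erase i, a j * y j) ⟂ᵢ[π] fun y => y i := by
    have h1 := (iIndepFun_const_mul_pi a).indepFun_finsetSum_of_notMem
      (fun i => by fun_prop) hi
    have h2 := h1.comp measurable_id (measurable_const_mul (a i)⁻¹)
    convert h2 using 1
    · funext y; simp
    · funext y
      simp [(ha i).ne']
  have hprod : π.map (fun y => (∑ j ∈ Finset.univ.erase i, a j * y j, y i)) = ρ.prod stdExp := by
    have := (indepFun_iff_map_prod_eq_prod_map_map hmR.aemeasurable hmi.aemeasurable).1 hind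
    rw [this, (measurePreserving_eval (fun _ : ι => stdExp) i).map_eq]
  calc ∫⁻ y, ENNReal.ofReal (y i) * φ (∑ j, a j * y j) ∂π
      = ∫⁻ p, ENNReal.ofReal p.2 * φ (p.1 + a i * p.2) ∂(ρ.prod stdExp) := by
        rw [← hprod, lintegral_map (by fun_prop) (by fun_prop)]
        simp_rw [hsplit, add_comm]
    _ = ∫⁻ r, ∫⁻ y, ENNReal.ofReal y * φ (r + a i * y) ∂stdExp ∂ρ :=
        lintegral_prod _ (by fun_prop)
    _ = ∫⁻ r, ∫⁻ z, φ (r + z)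
          ∂(stdExp.withDensity fun y => ENNReal.ofReal y).map (fun y => a i * y) ∂ρ := by
        refine lintegral_congr fun r => ?_
        rw [lintegral_map (by fun_prop) (by fun_prop),
          lintegral_withDensity_eq_lintegral_mul _ ENNReal.measurable_ofReal (by fun_prop)]
        rfl
    _ = ∫⁻ x, φ x ∂(ρ ∗ (stdExp.withDensity fun y => ENNReal.ofReal y).map (fun y => a i * y)) :=
        (Measure.lintegral_conv hφ).symm
    _ = ∫⁻ x, φ x ∂densityMeasure (expConv (a i) f) := by
        rw [map_mul_stdExp_withDensity (ha i), ← Measure.conv_assoc, ← hW,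
          densityMeasure_conv_exp (ha i) hf.continuous fun x hx => (hf.pos x hx).le]
    _ = _ := lintegral_densityMeasure (continuous_expConv hf.continuous) hφ

end Sums

lemma integrable_stdExp_id : Integrable (fun y : ℝ => y) stdExp := by
  refine ⟨measurable_id.aestronglyMeasurable, ?_⟩
  have h : ∀ᵐ y ∂stdExp, ‖y‖ₑ = ENNReal.ofReal y := by
    filter_upwards [ae_pos_stdExp] with y hy
    rw [Real.enorm_eq_ofReal hy.le]
  rw [HasFiniteIntegral, lintegral_congr_ae h, stdExp,
    lintegral_densityMeasure (by fun_prop) ENNReal.measurable_ofReal]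
  have hi : IntegrableOn (fun x : ℝ => Real.exp (-x) * x) (Set.Ioi 0) := by
    have := Real.GammaIntegral_convergent (s := 2) (by norm_num)
    refine this.congr_fun (fun x _ => ?_) measurableSet_Ioi
    norm_num
  refine lt_of_le_of_lt ?_ hi.2
  refine setLIntegral_mono' measurableSet_Ioi fun x hx => ?_
  rw [← ENNReal.ofReal_mul (Real.exp_pos _).le]
  exact Real.ofReal_le_enorm _

/-! ### Equalizing the weights below the mean. -/

section Tail

variable {ι : Type*} [Fintype ι]

/-- The probability that a combination of independent exponentials is at least `s`. -/
def expTail (a : ι → ℝ) (s : ℝ) : ℝ :=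
  (Measure.pi fun _ : ι => stdExp).real {y | s ≤ ∑ i, a i * y i}

lemma integrable_eval_pi (i : ι) :
    Integrable (fun y : ι → ℝ => y i) (Measure.pi fun _ : ι => stdExp) :=
  (measurePreserving_eval (fun _ : ι => stdExp) i).integrable_comp_of_integrable
    integrable_stdExp_id

lemma ae_pos_pi : ∀ᵐ y ∂(Measure.pi fun _ : ι => stdExp), ∀ i, 0 < y i := by
  rw [ae_all_iff]
  exact fun i => (measurePreserving_eval (fun _ : ι => stdExp) i).quasiMeasurePreserving.ae
    ae_pos_stdExp

lemma integral_eval_mul_pi {a : ι → ℝ} (ha : ∀ i, 0 < a i) {f : ℝ → ℝ} (hf : IsLogConcave f)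
    (hlaw : (Measure.pi fun _ : ι => stdExp).map (fun y => ∑ i, a i * y i) = densityMeasure f)
    (i : ι) {φ : ℝ → ℝ} (hφ : Continuous φ) (hφ0 : ∀ x, 0 ≤ φ x) {C : ℝ} (hC : ∀ x, φ x ≤ C) :
    IntegrableOn (fun x => expConv (a i) f x * φ x) (Set.Ioi 0) ∧
    ∫ y, y i * φ (∑ j, a j * y j) ∂(Measure.pi fun _ : ι => stdExp)
      = ∫ x in Set.Ioi 0, expConv (a i) f x * φ x := by
  have hU := continuous_expConv (a := a i) hf.continuous
  have key := lintegral_ofReal_mul_pi ha hf hlaw i (φ := fun x => ENNReal.ofReal (φ x))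
    (by fun_prop)
  have hint : Integrable (fun y : ι → ℝ => y i * φ (∑ j, a j * y j))
      (Measure.pi fun _ : ι => stdExp) := by
    have hm : Measurable fun y : ι → ℝ => φ (∑ j, a j * y j) := by fun_prop
    refine (integrable_eval_pi i).mul_bdd (c := C) hm.aestronglyMeasurable ?_
    filter_upwards with y
    rw [Real.norm_of_nonneg (hφ0 _)]
    exact hC _
  have hpos1 : 0 ≤ᵐ[Measure.pi fun _ : ι => stdExp] fun y => y i * φ (∑ j, a j * y j) := by
    filter_upwards [ae_pos_pi] with y hy using mul_nonneg (hy i).le (hφ0 _)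
  have hpos2 : 0 ≤ᵐ[volume.restrict (Set.Ioi 0)] fun x => expConv (a i) f x * φ x := by
    filter_upwards [ae_restrict_mem measurableSet_Ioi] with x hx
    exact mul_nonneg (hf.expConv_pos (ha i) hx).le (hφ0 _)
  have e1 : ∫⁻ y, ENNReal.ofReal (y i * φ (∑ j, a j * y j)) ∂(Measure.pi fun _ : ι => stdExp)
      = ∫⁻ x in Set.Ioi 0, ENNReal.ofReal (expConv (a i) f x * φ x) := by
    refine Eq.trans (lintegral_congr_ae ?_) (key.trans (lintegral_congr_ae ?_))
    · filter_upwards [ae_pos_pi] with y hy using ENNReal.ofReal_mul (hy i).le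
    · filter_upwards [ae_restrict_mem measurableSet_Ioi] with x hx
      exact (ENNReal.ofReal_mul (hf.expConv_pos (ha i) hx).le).symm
  refine ⟨⟨by fun_prop, ?_⟩, ?_⟩
  · rw [hasFiniteIntegral_iff_ofReal hpos2, ← e1]
    exact (hasFiniteIntegral_iff_ofReal hpos1).1 hint.2
  · rw [integral_eq_lintegral_of_nonneg_ae hpos1 (by fun_prop),
      integral_eq_lintegral_of_nonneg_ae hpos2 (by fun_prop), e1]

/-- Equalizing the weights increases the expectation of nondecreasing functions that are constant
above the mean. -/
lemma integral_comp_sum_le_uniform [Nonempty ι] {a : ι → ℝ} (ha : ∀ i, 0 < a i)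
    (hsum : ∑ i, a i = 1) {g g' : ℝ → ℝ} (hg : ∀ x, HasDerivAt g (g' x) x) (hg' : Continuous g')
    (hg0 : ∀ x, 0 ≤ g' x) (hg1 : ∀ x, 1 < x → g' x = 0) {C : ℝ} (hC : ∀ x, g' x ≤ C)
    (hgb : ∀ x, |g x| ≤ 1) :
    ∫ y, g (∑ i, a i * y i) ∂(Measure.pi fun _ : ι => stdExp)
      ≤ ∫ y, g (∑ i, 1 / (Fintype.card ι : ℝ) * y i) ∂(Measure.pi fun _ : ι => stdExp) := by
  set π := Measure.pi fun _ : ι => stdExp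
  set n : ℝ := (Fintype.card ι : ℝ) with hn
  have hn0 : 0 < n := by rw [hn]; exact_mod_cast Fintype.card_pos
  have hgc : Continuous g := continuous_iff_continuousAt.2 fun x => (hg x).continuousAt
  -- Straight path from the weights `a` at `t = 0` to equal weights at `t = 1`.
  let w : ℝ → (ι → ℝ) → ℝ := fun t y => ∑ i, (a i + t * (1 / n - a i)) * y i
  have hwd : ∀ y t, HasDerivAt (fun t => w t y) (∑ i, (1 / n - a i) * y i) t := fun y t => by
    refine HasDerivAt.fun_sum fun i _ => ?_
    have := (((hasDerivAt_id t).mul_const (1 / n - a i)).const_add (a i)).mul_const (y i)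
    simpa using this
  have hint : ∀ i t, Integrable (fun y : ι → ℝ => y i * g' (w t y)) π := fun i t => by
    have hm : Measurable fun y => g' (w t y) := by fun_prop
    refine (integrable_eval_pi i).mul_bdd (c := C) hm.aestronglyMeasurable ?_
    filter_upwards with y
    rw [Real.norm_of_nonneg (hg0 _)]
    exact hC _
  have hder : ∀ t, HasDerivAt (fun t => ∫ y, g (w t y) ∂π)
      (∫ y, g' (w t y) * ∑ i, (1 / n - a i) * y i ∂π) t := fun t => by
    refine (hasDerivAt_integral_of_dominated_loc_of_deriv_le (F := fun t y => g (w t y))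
      (F' := fun t y => g' (w t y) * ∑ i, (1 / n - a i) * y i)
      (bound := fun y => C * ∑ i, |1 / n - a i| * |y i|) (s := Set.univ) Filter.univ_mem
      ?_ ?_ ?_ ?_ ?_ ?_).2
    · filter_upwards with t
      have : Measurable fun y => g (w t y) := by fun_prop
      exact this.aestronglyMeasurable
    · refine Integrable.of_bound (C := 1) (by fun_prop) ?_
      filter_upwards with y using hgb _
    · have : Measurable fun y => g' (w t y) * ∑ i, (1 / n - a i) * y i := by fun_prop
      exact this.aestronglyMeasurable
    · filter_upwards with y t _
      rw [norm_mul, Real.norm_of_nonneg (hg0 _)]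
      refine mul_le_mul (hC _) ?_ (norm_nonneg _) ((hg0 0).trans (hC 0))
      refine (norm_sum_le _ _).trans (le_of_eq (Finset.sum_congr rfl fun i _ => ?_))
      rw [Real.norm_eq_abs, abs_mul]
    · exact (integrable_finsetSum _ fun i _ =>
        ((integrable_eval_pi i).abs.const_mul _)).const_mul C
    · filter_upwards with y t _
      exact (hg (w t y)).comp t (hwd y t)
  have hmono : MonotoneOn (fun t => ∫ y, g (w t y) ∂π) (Set.Icc 0 1) := by
    refine monotoneOn_of_deriv_nonneg (convex_Icc 0 1)
      (fun t _ => (hder t).continuousAt.continuousWithinAt)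
      (fun t _ => (hder t).differentiableAt.differentiableWithinAt) fun t ht => ?_
    rw [interior_Icc] at ht
    rw [(hder t).deriv]
    set b : ι → ℝ := fun i => a i + t * (1 / n - a i) with hb
    have hbpos : ∀ i, 0 < b i := fun i => by
      have h1 : 0 < (1 - t) * a i := mul_pos (by linarith [ht.2]) (ha i)
      have h2 : 0 < t * (1 / n) := mul_pos ht.1 (by positivity)
      simp only [hb]; linarith
    have hbsum : ∑ i, b i = 1 := by
      simp only [hb, Finset.sum_add_distrib, ← Finset.mul_sum, Finset.sum_sub_distrib, hsum,
        Finset.sum_const, Finset.card_univ, nsmul_eq_mul, ← hn]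
      field_simp
      ring
    obtain ⟨f, hf, hfsum, hflaw⟩ := exists_density_sum hbpos Finset.univ_nonempty
    have hcalc : ∀ i, _ := fun i => integral_eval_mul_pi hbpos hf hflaw i hg' hg0 hC
    have e1 : ∫ y, g' (w t y) * ∑ i, (1 / n - a i) * y i ∂π
        = ∑ i, (1 / n - a i) * ∫ y, y i * g' (w t y) ∂π := by
      simp_rw [← integral_const_mul]
      rw [← integral_finsetSum _ fun i _ => (hint i t).const_mul _]
      congr 1
      funext y
      rw [Finset.mul_sum]
      exact Finset.sum_congr rfl fun i _ => by ring
    have e2 : ∑ i, (1 / n - a i) * ∫ y, y i * g' (w t y) ∂π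
        = ∫ x in Set.Ioi 0, g' x * ∑ i, (1 / n - a i) * expConv (b i) f x := by
      have hc2 : ∀ i, ∫ y, y i * g' (w t y) ∂π
          = ∫ x in Set.Ioi 0, expConv (b i) f x * g' x := fun i => (hcalc i).2
      simp_rw [hc2, ← integral_const_mul]
      rw [← integral_finsetSum _ fun i _ => (hcalc i).1.integrable.const_mul _]
      congr 1
      funext x
      rw [Finset.mul_sum]
      exact Finset.sum_congr rfl fun i _ => by ring
    rw [e1, e2]
    refine setIntegral_nonneg measurableSet_Ioi fun x hx => ?_
    rcases le_or_gt x 1 with hx1 | hx1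
    · refine mul_nonneg (hg0 x) ?_
      have := hf.sum_sub_mul_expConv_nonneg (fun i _ => hbpos i) Finset.univ_nonempty hx hx1 hbsum
        (hfsum x hx)
      rw [Finset.card_univ, ← hn] at this
      -- `1 / n - b i = (1 - t) * (1 / n - a i)`, so the inequality at the intermediate weights `b`
      -- gives the sign in the direction of the path.
      have e3 : ∑ i, (1 / n - b i) * expConv (b i) f x
          = (1 - t) * ∑ i, (1 / n - a i) * expConv (b i) f x := by
        rw [Finset.mul_sum]
        refine Finset.sum_congr rfl fun i _ => ?_
        rw [← mul_assoc]
        congr 1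
        simp only [hb]; ring
      rw [e3] at this
      exact nonneg_of_mul_nonneg_right this (by linarith [ht.2])
    · rw [hg1 x hx1, zero_mul]
  have := hmono (Set.left_mem_Icc.2 zero_le_one) (Set.right_mem_Icc.2 zero_le_one) zero_le_one
  simpa [w] using this

end Tail

/-! ### Differential inequality for the density, and tails for positive weights. -/

lemma exists_deriv_smoothTransition_le : ∃ C, ∀ x, deriv Real.smoothTransition x ≤ C := by
  have hc : Continuous (deriv Real.smoothTransition) :=
    (Real.smoothTransition.contDiff (n := 1)).continuous_deriv le_rfl
  obtain ⟨C, hC⟩ := (isCompact_Icc (a := (0 : ℝ)) (b := 1)).bddAbove_image hc.continuousOn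
  refine ⟨max C 0, fun x => ?_⟩
  rcases lt_or_ge x 0 with h | h
  · have : Real.smoothTransition =ᶠ[𝓝 x] fun _ => 0 := by
      filter_upwards [gt_mem_nhds h] with y hy using Real.smoothTransition.zero_of_nonpos hy.le
    rw [this.deriv_eq]; simp
  rcases lt_or_ge 1 x with h' | h'
  · have : Real.smoothTransition =ᶠ[𝓝 x] fun _ => 1 := by
      filter_upwards [lt_mem_nhds h'] with y hy using Real.smoothTransition.one_of_one_le hy.le
    rw [this.deriv_eq]; simp
  · exact (hC ⟨x, ⟨h, h'⟩, rfl⟩).trans (le_max_left _ _)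

/-- Differentiability comes from `x f = ∑ a i * expConv (a i) f`, whose right side is differentiable
for merely continuous `f`. -/
lemma IsLogConcave.hasDerivAt {f : ℝ → ℝ} (hf : IsLogConcave f) {ι : Type*} {s : Finset ι}
    {a : ι → ℝ} (ha : ∀ i ∈ s, a i ≠ 0)
    (hsum : ∀ x, 0 < x → x * f x = ∑ i ∈ s, a i * MIMO.expConv (a i) f x) {x : ℝ} (hx : 0 < x) :
    HasDerivAt f ((-∑ i ∈ s, (MIMO.expConv (a i) f x - f x) - f x) / x) x := by
  have h1 : HasDerivAt (fun x => ∑ i ∈ s, a i * MIMO.expConv (a i) f x)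
      (∑ i ∈ s, a i * ((f x - MIMO.expConv (a i) f x) / a i)) x :=
    HasDerivAt.fun_sum fun i _ => (hasDerivAt_expConv hf.continuous x).const_mul (a i)
  have h2 := h1.div (hasDerivAt_id x) hx.ne'
  have heq : f =ᶠ[𝓝 x] (fun x => ∑ i ∈ s, a i * MIMO.expConv (a i) f x) / id := by
    filter_upwards [lt_mem_nhds hx] with y hy
    rw [Pi.div_apply, ← hsum y hy, id, mul_div_cancel_left₀ _ hy.ne']
  refine (h2.congr_of_eventuallyEq heq).congr_deriv ?_
  have e : ∑ i ∈ s, a i * ((f x - MIMO.expConv (a i) f x) / a i)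
      = -∑ i ∈ s, (MIMO.expConv (a i) f x - f x) := by
    rw [← Finset.sum_neg_distrib]
    refine Finset.sum_congr rfl fun i hi => ?_
    have := ha i hi
    field_simp
    ring
  rw [e, ← hsum x hx]
  simp only [id]
  field_simp

lemma IsLogConcave.deriv_mul_le {f : ℝ → ℝ} (hf : IsLogConcave f) {x x' d d' : ℝ} (hx : 0 < x)
    (hxx : x ≤ x') (hd : HasDerivAt f d x) (hd' : HasDerivAt f d' x') : d' * f x ≤ d * f x' := by
  have h1 := (hd'.mul_const (f x)).tendsto_slope_zero_right
  have h2 := (hd.mul_const (f x')).tendsto_slope_zero_right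
  refine le_of_tendsto_of_tendsto h1 h2 ?_
  filter_upwards [self_mem_nhdsWithin] with h hh
  have hh : 0 < h := hh
  have := hf.le x x' h hx hxx hh.le
  simp only [smul_eq_mul]
  refine mul_le_mul_of_nonneg_left ?_ (by positivity)
  linarith [mul_comm (f x) (f x')]

/-- If `f` is log-concave and `x f' ≤ -f` at `s`, then `∫ₛ^∞ f ≤ s f(s)`. -/
lemma IsLogConcave.integral_Ioi_le {f f' : ℝ → ℝ} (hf : IsLogConcave f)
    (hd : ∀ x, 0 < x → HasDerivAt f (f' x) x) {s : ℝ} (hs : 0 < s) (hle : s * f' s ≤ -f s)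
    (hint : IntegrableOn f (Set.Ioi s)) : ∫ x in Set.Ioi s, f x ≤ s * f s := by
  have hφ : ∀ x, 0 < x → HasDerivAt (fun x => f x * Real.exp (x / s))
      (f' x * Real.exp (x / s) + f x * (Real.exp (x / s) * (1 / s))) x := fun x hx =>
    (hd x hx).mul (((hasDerivAt_id x).div_const s).exp)
  -- The hypothesis is `(log f)' ≤ -1 / s` at `s`; log-concavity propagates it to all larger `x`.
  have hanti : AntitoneOn (fun x => f x * Real.exp (x / s)) (Set.Ici s) := by
    refine antitoneOn_of_deriv_nonpos (convex_Ici s)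
      (fun x hx => (hφ x (hs.trans_le hx)).continuousAt.continuousWithinAt) ?_ ?_
    · intro x hx
      rw [interior_Ici] at hx
      exact (hφ x (hs.trans hx)).differentiableAt.differentiableWithinAt
    · intro x hx
      rw [interior_Ici] at hx
      have hx : s < x := hx
      rw [(hφ x (hs.trans hx)).deriv]
      have h1 := hf.deriv_mul_le hs hx.le (hd s hs) (hd x (hs.trans hx))
      have hfs := hf.pos s hs
      have hfx := hf.pos x (hs.trans hx)
      have h2 : (s * f' x + f x) * f s ≤ 0 := by
        nlinarith [mul_le_mul_of_nonneg_left h1 hs.le, mul_le_mul_of_nonneg_right hle hfx.le]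
      have h3 : s * f' x + f x ≤ 0 := nonpos_of_mul_nonpos_left h2 hfs
      have e : f' x * Real.exp (x / s) + f x * (Real.exp (x / s) * (1 / s))
          = (s * f' x + f x) * (Real.exp (x / s) / s) := by field_simp
      rw [e]
      exact mul_nonpos_of_nonpos_of_nonneg h3 (by positivity)
  have hneg : -(1 / s) < 0 := by simp [hs]
  have hbound : ∀ x ∈ Set.Ioi s, f x ≤ f s * Real.exp 1 * Real.exp (-(1 / s) * x) := by
    intro x hx
    have h := hanti (Set.mem_Ici.2 le_rfl) (Set.mem_Ici.2 (le_of_lt hx)) (le_of_lt hx)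
    simp only [div_self hs.ne'] at h
    have e : Real.exp (-(1 / s) * x) = (Real.exp (x / s))⁻¹ := by
      rw [← Real.exp_neg]; ring_nf
    rw [e, ← div_eq_mul_inv, le_div_iff₀ (Real.exp_pos _)]
    exact h
  calc ∫ x in Set.Ioi s, f x
      ≤ ∫ x in Set.Ioi s, f s * Real.exp 1 * Real.exp (-(1 / s) * x) :=
        setIntegral_mono_on hint ((integrableOn_exp_mul_Ioi hneg s).const_mul _)
          measurableSet_Ioi hbound
    _ = s * f s := by
        rw [integral_const_mul, integral_exp_mul_Ioi hneg]
        have : Real.exp (-(1 / s) * s) = (Real.exp 1)⁻¹ := by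
          rw [← Real.exp_neg]; congr 1; field_simp
        rw [this]
        field_simp

lemma real_densityMeasure_Ici {f : ℝ → ℝ} (hf : Continuous f) (hpos : ∀ x, 0 < x → 0 ≤ f x)
    [IsFiniteMeasure (densityMeasure f)] :
    IntegrableOn f (Set.Ioi 0) ∧
      ∀ s, 0 ≤ s → (densityMeasure f).real (Set.Ici s) = ∫ x in Set.Ioi s, f x := by
  have hnn : ∀ s : ℝ, 0 ≤ s → 0 ≤ᵐ[volume.restrict (Set.Ioi s)] f := fun s hs => by
    filter_upwards [ae_restrict_mem measurableSet_Ioi] with x hx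
    exact hpos x (hs.trans_lt hx)
  have hset : ∀ s, 0 ≤ s → densityMeasure f (Set.Ici s)
      = ∫⁻ x in Set.Ioi s, ENNReal.ofReal (f x) := fun s hs => by
    rw [densityMeasure, withDensity_apply _ measurableSet_Ici,
      setLIntegral_congr Ioi_ae_eq_Ici.symm]
    refine setLIntegral_congr_fun measurableSet_Ioi fun x hx => ?_
    exact Set.indicator_of_mem (Set.mem_Ioi.2 (hs.trans_lt hx)) _
  have hint : IntegrableOn f (Set.Ioi 0) := by
    refine ⟨hf.aestronglyMeasurable, ?_⟩
    rw [hasFiniteIntegral_iff_ofReal (hnn 0 le_rfl), ← hset 0 le_rfl]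
    exact measure_lt_top _ _
  refine ⟨hint, fun s hs => ?_⟩
  rw [measureReal_def, hset s hs,
    integral_eq_lintegral_of_nonneg_ae (hnn s hs) hf.aestronglyMeasurable]

section Tail

variable {ι : Type*} [Fintype ι]

lemma expTail_eq_map (a : ι → ℝ) (s : ℝ) : expTail a s
    = ((Measure.pi fun _ : ι => stdExp).map fun y => ∑ i, a i * y i).real (Set.Ici s) := by
  rw [expTail, measureReal_def, measureReal_def, Measure.map_apply (by fun_prop) measurableSet_Ici]
  rfl

lemma exists_expTail_density [Nonempty ι] {a : ι → ℝ} (ha : ∀ i, 0 < a i) :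
    ∃ f : ℝ → ℝ, IsLogConcave f ∧
      (∀ x, 0 < x → x * f x = ∑ i, a i * expConv (a i) f x) ∧
      IntegrableOn f (Set.Ioi 0) ∧ ∀ s, 0 ≤ s → expTail a s = ∫ x in Set.Ioi s, f x := by
  obtain ⟨f, hf, hsum, hlaw⟩ := exists_density_sum ha Finset.univ_nonempty
  have : IsFiniteMeasure (densityMeasure f) := by rw [← hlaw]; infer_instance
  obtain ⟨h1, h2⟩ := real_densityMeasure_Ici hf.continuous fun x hx => (hf.pos x hx).le
  exact ⟨f, hf, hsum, h1, fun s hs => by rw [expTail_eq_map, hlaw, h2 s hs]⟩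

lemma hasDerivAt_integral_Ioi {f : ℝ → ℝ} (hf : Continuous f) (hint : IntegrableOn f (Set.Ioi 0))
    {x : ℝ} (hx : 0 < x) : HasDerivAt (fun s => ∫ x in Set.Ioi s, f x) (-f x) x := by
  have h1 : HasDerivAt (fun s => (∫ x in Set.Ioi 0, f x) - ∫ y in (0 : ℝ)..s, f y) (-f x) x :=
    (intervalIntegral.integral_hasDerivAt_right (hf.intervalIntegrable _ _)
      (hf.stronglyMeasurableAtFilter _ _) hf.continuousAt).const_sub _
  refine h1.congr_of_eventuallyEq ?_
  filter_upwards [lt_mem_nhds hx] with s hs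
  rw [← intervalIntegral.integral_interval_add_Ioi hint (hint.mono_set (Set.Ioi_subset_Ioi hs.le))]
  ring

lemma continuousOn_integral_Ioi {f : ℝ → ℝ} (hf : Continuous f)
    (hint : IntegrableOn f (Set.Ioi 0)) :
    ContinuousOn (fun s => ∫ x in Set.Ioi s, f x) (Set.Ici 0) := by
  have h1 : Continuous (fun s => (∫ x in Set.Ioi 0, f x) - ∫ y in (0 : ℝ)..s, f y) :=
    continuous_const.sub (intervalIntegral.continuous_primitive (fun _ _ =>
      hf.intervalIntegrable _ _) _)
  refine h1.continuousOn.congr fun s hs => ?_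
  rw [← intervalIntegral.integral_interval_add_Ioi hint (hint.mono_set (Set.Ioi_subset_Ioi hs))]
  ring

lemma continuousOn_expTail [Nonempty ι] {a : ι → ℝ} (ha : ∀ i, 0 < a i) :
    ContinuousOn (expTail a) (Set.Ici 0) := by
  obtain ⟨f, hf, -, hint, htail⟩ := exists_expTail_density ha
  exact (continuousOn_integral_Ioi hf.continuous hint).congr fun s hs => htail s hs

/-- The last inequality says that `x * expTail a x` has nonpositive derivative. At `x = 1` it also
serves to exclude the right endpoint as a maximizer. -/
lemma exists_hasDerivAt_expTail [Nonempty ι] {a : ι → ℝ} (ha : ∀ i, 0 < a i)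
    (hsum : ∑ i, a i = 1) : ∃ f : ℝ → ℝ, ∀ x, 1 ≤ x →
      0 < f x ∧ HasDerivAt (expTail a) (-f x) x ∧ expTail a x ≤ x * f x := by
  obtain ⟨f, hf, hfsum, hint, htail⟩ := exists_expTail_density ha
  refine ⟨f, fun x hx => ?_⟩
  have hx0 : 0 < x := by linarith
  refine ⟨hf.pos x hx0, ?_, ?_⟩
  · refine (hasDerivAt_integral_Ioi hf.continuous hint hx0).congr_of_eventuallyEq ?_
    filter_upwards [lt_mem_nhds hx0] with y hy using htail y hy.le
  · rw [htail x hx0.le]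
    refine hf.integral_Ioi_le (fun x hx => hf.hasDerivAt (s := Finset.univ)
      (fun i _ => (ha i).ne') hfsum hx) hx0 ?_ (hint.mono_set (Set.Ioi_subset_Ioi hx0.le))
    rw [mul_div_cancel₀ _ hx0.ne']
    have := hf.sum_expConv_sub_nonneg (s := Finset.univ) (fun i _ => ha i) hx0
      (by rw [hsum]; exact hx) (hfsum x hx0)
    linarith

/-- Above the mean, `s P(W ≥ s)` is nonincreasing in `s`. -/
lemma mul_expTail_le [Nonempty ι] {a : ι → ℝ} (ha : ∀ i, 0 < a i) (hsum : ∑ i, a i = 1)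
    {s : ℝ} (hs : 1 ≤ s) : s * expTail a s ≤ expTail a 1 := by
  obtain ⟨f, hf⟩ := exists_hasDerivAt_expTail ha hsum
  have hk : ∀ x, 1 ≤ x → HasDerivAt (fun s => s * expTail a s)
      (1 * expTail a x + x * (-f x)) x := fun x hx => (hasDerivAt_id x).mul (hf x hx).2.1
  have hanti : AntitoneOn (fun s => s * expTail a s) (Set.Ici 1) := by
    refine antitoneOn_of_deriv_nonpos (convex_Ici 1)
      (fun x hx => (hk x hx).continuousAt.continuousWithinAt) ?_ ?_
    · intro x hx
      rw [interior_Ici] at hx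
      exact (hk x (le_of_lt hx)).differentiableAt.differentiableWithinAt
    · intro x hx
      rw [interior_Ici] at hx
      rw [(hk x (le_of_lt hx)).deriv]
      linarith [(hf x (le_of_lt hx)).2.2]
  have := hanti (Set.mem_Ici.2 le_rfl) (Set.mem_Ici.2 hs) hs
  simpa using this

/-- The indicator of `[s, ∞)` is replaced by a smooth step rising from `0` at `s - δ` to `1` at `s`.
As `s ≤ 1`, the step is constant above the mean, as `integral_comp_sum_le_uniform` requires. -/
lemma expTail_le_uniform_sub [Nonempty ι] {a : ι → ℝ} (ha : ∀ i, 0 < a i) (hsum : ∑ i, a i = 1)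
    {s δ : ℝ} (hs : s ≤ 1) (hδ : 0 < δ) :
    expTail a s ≤ expTail (fun _ : ι => 1 / (Fintype.card ι : ℝ)) (s - δ) := by
  obtain ⟨C, hC⟩ := exists_deriv_smoothTransition_le
  have hst : ContDiff ℝ 1 Real.smoothTransition := Real.smoothTransition.contDiff (n := 1)
  have hc : Continuous (deriv Real.smoothTransition) := hst.continuous_deriv le_rfl
  set g : ℝ → ℝ := fun x => Real.smoothTransition ((x - (s - δ)) / δ) with hg
  have hgd : ∀ x, HasDerivAt g (deriv Real.smoothTransition ((x - (s - δ)) / δ) * (1 / δ)) x := by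
    intro x
    have h1 := (hst.differentiable one_ne_zero).differentiableAt
      (x := (x - (s - δ)) / δ) |>.hasDerivAt
    exact h1.comp x (((hasDerivAt_id x).sub_const (s - δ)).div_const δ)
  have hgm : Measurable g := by
    have : Continuous g := continuous_iff_continuousAt.2 fun x => (hgd x).continuousAt
    exact this.measurable
  have hgb : ∀ x, |g x| ≤ 1 := fun x => by
    rw [abs_of_nonneg (Real.smoothTransition.nonneg _)]
    exact Real.smoothTransition.le_one _
  have hmain := integral_comp_sum_le_uniform ha hsum hgd (by fun_prop)
    (fun x => mul_nonneg Real.smoothTransition.monotone.deriv_nonneg (by positivity))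
    (fun x hx => by
      have : Real.smoothTransition =ᶠ[𝓝 ((x - (s - δ)) / δ)] fun _ => 1 := by
        have h1 : 1 < (x - (s - δ)) / δ := by rw [lt_div_iff₀ hδ]; linarith
        filter_upwards [lt_mem_nhds h1] with y hy using Real.smoothTransition.one_of_one_le hy.le
      rw [this.deriv_eq]; simp)
    (C := C * (1 / δ)) (fun x => mul_le_mul_of_nonneg_right (hC _) (by positivity)) hgb
  have hgint : ∀ b : ι → ℝ, Integrable (fun y : ι → ℝ => g (∑ i, b i * y i))
      (Measure.pi fun _ : ι => stdExp) := fun b => by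
    have hm : Measurable fun y : ι → ℝ => g (∑ i, b i * y i) := by fun_prop
    refine Integrable.of_bound (C := 1) hm.aestronglyMeasurable ?_
    filter_upwards with y using hgb _
  have hms : ∀ (b : ι → ℝ) (r : ℝ), MeasurableSet {y : ι → ℝ | r ≤ ∑ i, b i * y i} := fun b r =>
    measurableSet_le measurable_const (by fun_prop)
  have hind : ∀ (b : ι → ℝ) (r : ℝ), Integrable
      ({y : ι → ℝ | r ≤ ∑ i, b i * y i}.indicator fun _ => (1 : ℝ))
      (Measure.pi fun _ : ι => stdExp) := fun b r =>
    (integrable_const 1).indicator (hms b r)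
  have htail : ∀ (b : ι → ℝ) (r : ℝ), expTail b r = ∫ y,
      {y : ι → ℝ | r ≤ ∑ i, b i * y i}.indicator (fun _ => (1 : ℝ)) y
        ∂(Measure.pi fun _ : ι => stdExp) := fun b r => by
    rw [integral_indicator (hms b r)]
    simp [expTail]
  refine le_trans ?_ (hmain.trans ?_)
  · rw [htail]
    refine integral_mono (hind a s) (hgint a)
      (Set.indicator_le' (fun y hy => ?_) fun y _ => Real.smoothTransition.nonneg _)
    have hy : s ≤ ∑ i, a i * y i := hy
    refine (Real.smoothTransition.one_of_one_le ?_).ge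
    rw [le_div_iff₀ hδ]; linarith
  · rw [htail]
    refine integral_mono (hgint _) (hind _ (s - δ))
      (Set.le_indicator (fun y hy => Real.smoothTransition.le_one _) fun y hy => ?_)
    have hy : ¬ s - δ ≤ _ := hy
    refine (Real.smoothTransition.zero_of_nonpos ?_).le
    exact div_nonpos_of_nonpos_of_nonneg (by linarith) hδ.le

end Tail

/-! ### Degenerate weights by approximation, and the gamma tail for equal weights. -/

section Tail

variable {ι : Type*} [Fintype ι]

lemma expTail_mono {a b : ι → ℝ} (hab : ∀ i, a i ≤ b i) (s : ℝ) : expTail a s ≤ expTail b s := by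
  refine ENNReal.toReal_mono (measure_ne_top _ _) (measure_mono_ae ?_)
  filter_upwards [ae_pos_pi] with y hy
  intro (h : s ≤ ∑ i, a i * y i)
  exact h.trans (Finset.sum_le_sum fun i _ => mul_le_mul_of_nonneg_right (hab i) (hy i).le)

lemma expTail_const_mul {m : ℝ} (hm : 0 < m) (a : ι → ℝ) (s : ℝ) :
    expTail (fun i => m * a i) (m * s) = expTail a s := by
  simp only [expTail, mul_assoc, ← Finset.mul_sum, mul_le_mul_iff_right₀ hm]

/-- Raise all weights by the same positive amount until they sum to `m`, then divide by `m`. This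
reaches zero weights and deficient sums at the price of the level `s / m`. -/
lemma exists_expTail_le [Nonempty ι] {a : ι → ℝ} (ha : ∀ i, 0 ≤ a i) (hsum : ∑ i, a i ≤ 1)
    {m : ℝ} (hm : 1 < m) (s : ℝ) :
    ∃ b : ι → ℝ, (∀ i, 0 < b i) ∧ ∑ i, b i = 1 ∧ expTail a s ≤ expTail b (s / m) := by
  set n : ℝ := (Fintype.card ι : ℝ) with hn
  have hn0 : 0 < n := by rw [hn]; exact_mod_cast Fintype.card_pos
  have hm0 : 0 < m := by linarith
  have hd : 0 < (m - ∑ i, a i) / n := div_pos (by linarith) hn0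
  refine ⟨fun i => m⁻¹ * (a i + (m - ∑ i, a i) / n), fun i => ?_, ?_, ?_⟩
  · have := ha i
    positivity
  · rw [← Finset.mul_sum, Finset.sum_add_distrib, Finset.sum_const, Finset.card_univ, nsmul_eq_mul,
      ← hn]
    field_simp
    ring
  · rw [div_eq_inv_mul s m, expTail_const_mul (inv_pos.2 hm0)]
    exact expTail_mono (fun i => by linarith) s

/-- Equal weights maximize the probability that a combination of independent exponentials exceeds
a level below its mean. -/
lemma expTail_le_uniform [Nonempty ι] {a : ι → ℝ} (ha : ∀ i, 0 ≤ a i) (hsum : ∑ i, a i ≤ 1)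
    {s : ℝ} (hs0 : 0 < s) (hs : s ≤ 1) :
    expTail a s ≤ expTail (fun _ : ι => 1 / (Fintype.card ι : ℝ)) s := by
  have hn0 : (0 : ℝ) < Fintype.card ι := by exact_mod_cast Fintype.card_pos
  have hc : ContinuousAt (expTail fun _ : ι => 1 / (Fintype.card ι : ℝ)) s :=
    (continuousOn_expTail fun _ => by positivity).continuousAt (Ici_mem_nhds hs0)
  refine ge_of_tendsto (hc.tendsto.mono_left (nhdsWithin_le_nhds (s := Set.Iio s))) ?_
  have h0 : ∀ᶠ r in 𝓝[<] s, 0 < r := nhdsWithin_le_nhds (lt_mem_nhds hs0)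
  filter_upwards [h0, self_mem_nhdsWithin] with r hr hrs
  have hrs : r < s := hrs
  -- This `m` lies strictly between `1` and `s / r`, so `r < s / m`; the gap is the `δ` of the
  -- smooth comparison. Continuity of the equal-weight tail then lets `r` increase to `s`.
  have hm : 1 < (1 + s / r) / 2 := by
    have : 1 < s / r := by rwa [one_lt_div hr]
    linarith
  obtain ⟨b, hb, hbsum, hle⟩ := exists_expTail_le ha hsum hm s
  refine hle.trans ?_
  have h1 : s / ((1 + s / r) / 2) ≤ 1 := (div_le_one (by linarith)).2 (by linarith)
  have h2 : 0 < s / ((1 + s / r) / 2) - r := by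
    rw [sub_pos, lt_div_iff₀ (by linarith)]
    have : r * ((1 + s / r) / 2) = (r + s) / 2 := by field_simp
    linarith
  have := expTail_le_uniform_sub hb hbsum h1 h2
  rwa [sub_sub_cancel] at this

lemma mul_expTail_le_uniform [Nonempty ι] {a : ι → ℝ} (ha : ∀ i, 0 ≤ a i) (hsum : ∑ i, a i ≤ 1)
    {s : ℝ} (hs : 1 ≤ s) :
    s * expTail a s ≤ expTail (fun _ : ι => 1 / (Fintype.card ι : ℝ)) 1 := by
  rcases hs.eq_or_lt with rfl | hs
  · rw [one_mul]
    exact expTail_le_uniform ha hsum zero_lt_one le_rfl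
  have ht : Tendsto (fun m => m * expTail (fun _ : ι => 1 / (Fintype.card ι : ℝ)) 1) (𝓝[>] 1)
      (𝓝 (1 * expTail (fun _ : ι => 1 / (Fintype.card ι : ℝ)) 1)) :=
    ((continuous_id.mul continuous_const).tendsto 1).mono_left nhdsWithin_le_nhds
  rw [one_mul] at ht
  refine ge_of_tendsto ht ?_
  -- For `1 < m < s` the reduced level `s / m` stays above the mean; the loss is a factor `m`, which
  -- tends to `1`.
  filter_upwards [Ioo_mem_nhdsGT hs] with m hm
  obtain ⟨b, hb, hbsum, hle⟩ := exists_expTail_le ha hsum hm.1 s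
  have hm0 : 0 < m := by linarith [hm.1]
  have h1 := mul_expTail_le hb hbsum (s := s / m) (by rw [le_div_iff₀ hm0]; linarith [hm.2])
  have h2 := expTail_le_uniform (fun i => (hb i).le) hbsum.le zero_lt_one le_rfl
  have h3 : s / m * expTail a s ≤ s / m * expTail b (s / m) :=
    mul_le_mul_of_nonneg_left hle (by have := hs; positivity)
  have h4 := mul_le_mul_of_nonneg_left (h3.trans (h1.trans h2)) hm0.le
  have e : m * (s / m * expTail a s) = s * expTail a s := by field_simp
  rwa [e] at h4

lemma expConv_gamma (n : ℕ) (x : ℝ) :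
    expConv 1 (fun x => x ^ n * Real.exp (-x) / n.factorial) x
      = x ^ (n + 1) * Real.exp (-x) / (n + 1).factorial := by
  refine (congrFun (eq_expConv (u := fun x => x ^ (n + 1) * Real.exp (-x) / (n + 1).factorial)
    one_ne_zero (by fun_prop) (by simp) fun x => ?_) x).symm
  have h := ((hasDerivAt_pow (n + 1) x).mul ((hasDerivAt_id x).neg.exp)).div_const
    ((n + 1).factorial : ℝ)
  refine h.congr_deriv ?_
  have : (n.factorial : ℝ) ≠ 0 := by positivity
  simp [Nat.factorial_succ]
  field_simp
  ring

lemma map_sum_pi_gamma {s : Finset ι} (hs : s.Nonempty) :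
    (Measure.pi fun _ : ι => stdExp).map (fun y => ∑ i ∈ s, 1 * y i)
      = densityMeasure fun x => x ^ (s.card - 1) * Real.exp (-x) / (s.card - 1).factorial := by
  induction hs using Finset.Nonempty.cons_induction with
  | singleton i =>
    simp only [Finset.sum_singleton]
    rw [map_const_mul_eval_pi (a := fun _ => 1) (fun _ => one_pos) i]
    simp
  | cons i s hi hs ih =>
    simp only [Finset.sum_cons]
    rw [map_sum_insert_pi (a := fun _ => 1) (fun _ => one_pos) s hi, ih,
      densityMeasure_conv_exp one_pos (by fun_prop) fun x hx => by positivity]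
    refine densityMeasure_congr fun x _ => ?_
    rw [expConv_gamma, Finset.card_cons]
    have := hs.card_pos
    rw [show s.card - 1 + 1 = s.card by omega, Nat.add_sub_cancel]

lemma expTail_uniform_eq [Nonempty ι] {s : ℝ} (hs : 0 ≤ s) :
    expTail (fun _ : ι => 1 / (Fintype.card ι : ℝ)) s
      = upperGamma (Fintype.card ι) (Fintype.card ι * s) / (Fintype.card ι - 1).factorial := by
  have hn : 0 < Fintype.card ι := Fintype.card_pos
  have hn0 : (0 : ℝ) < Fintype.card ι := by exact_mod_cast hn
  rw [← expTail_const_mul hn0]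
  have e : (fun i : ι => (Fintype.card ι : ℝ) * (1 / (Fintype.card ι : ℝ))) = fun _ => 1 := by
    funext i; field_simp
  rw [e, expTail_eq_map]
  have hlaw := map_sum_pi_gamma (ι := ι) Finset.univ_nonempty
  rw [Finset.card_univ] at hlaw
  set f : ℝ → ℝ := fun x => x ^ (Fintype.card ι - 1) * Real.exp (-x) / (Fintype.card ι - 1).factorial
    with hf
  have : IsFiniteMeasure (densityMeasure f) := by rw [← hlaw]; infer_instance
  rw [hlaw, (real_densityMeasure_Ici (by fun_prop) fun x hx => by positivity).2 _ (by positivity),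
    hf, integral_div, upperGamma]
  congr 1
  refine integral_congr_ae (ae_of_all _ fun x => ?_)
  simp only
  rw [← Nat.cast_pred hn, Real.rpow_natCast]

end Tail

/-! ### Complex Gaussian matrices: unitary invariance and squared moduli. -/

lemma measurable_complex_mk : Measurable fun p : ℝ × ℝ => (⟨p.1, p.2⟩ : ℂ) :=
  Complex.measurableEquivRealProd.symm.measurable

instance : IsProbabilityMeasure stdComplexGaussian :=
  Measure.isProbabilityMeasure_map measurable_complex_mk.aemeasurable

lemma charFun_stdComplexGaussian (t : ℂ) :
    charFun stdComplexGaussian t = Complex.exp (-((‖t‖ ^ 2 / 4 : ℝ) : ℂ)) := by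
  rw [charFun_apply, stdComplexGaussian, integral_map measurable_complex_mk.aemeasurable
    (by fun_prop)]
  have h : ∀ p : ℝ × ℝ, Complex.exp (((inner ℝ (⟨p.1, p.2⟩ : ℂ) t : ℝ) : ℂ) * Complex.I)
      = Complex.exp (((inner ℝ p.1 t.re : ℝ) : ℂ) * Complex.I)
        * Complex.exp (((inner ℝ p.2 t.im : ℝ) : ℂ) * Complex.I) := fun p => by
    rw [← Complex.exp_add, ← add_mul]
    congr 2
    rw [← Complex.ofReal_add]
    congr 1
    simp [Complex.inner]
  simp_rw [h]
  rw [integral_prod_mul (fun x : ℝ => Complex.exp (((inner ℝ x t.re : ℝ) : ℂ) * Complex.I))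
    (fun x : ℝ => Complex.exp (((inner ℝ x t.im : ℝ) : ℂ) * Complex.I)), ← charFun_apply,
    ← charFun_apply, charFun_gaussianReal, charFun_gaussianReal, ← Complex.exp_add]
  congr 1
  rw [← Complex.normSq_eq_norm_sq, Complex.normSq_apply]
  push_cast
  ring

section Unitary

variable {m n : ℕ}

lemma sum_inner_eq_re_trace (A B : Matrix (Fin m) (Fin n) ℂ) :
    ∑ p : Fin m × Fin n, inner ℝ (A p.1 p.2) (B p.1 p.2) = (B * Aᴴ).trace.re := by
  rw [Fintype.sum_prod_type, Matrix.trace, Complex.re_sum]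
  refine Finset.sum_congr rfl fun i _ => ?_
  rw [Matrix.diag_apply, Matrix.mul_apply, Complex.re_sum]
  refine Finset.sum_congr rfl fun j _ => ?_
  simp only [Matrix.conjTranspose_apply, Complex.inner]
  rfl

/-- An i.i.d. complex Gaussian matrix is invariant in law under right multiplication by a unitary
matrix. -/
lemma map_mul_unitary_pi (U : Matrix.unitaryGroup (Fin n) ℂ) :
    (Measure.pi fun _ : Fin m × Fin n => stdComplexGaussian).map
      (fun h (p : Fin m × Fin n) => (Matrix.of (fun k l => h (k, l)) * (U : Matrix (Fin n) (Fin n) ℂ)) p.1 p.2)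
      = Measure.pi fun _ => stdComplexGaussian := by
  have hmeas : Measurable fun (h : Fin m × Fin n → ℂ) (p : Fin m × Fin n) =>
      (Matrix.of (fun k l => h (k, l)) * (U : Matrix (Fin n) (Fin n) ℂ)) p.1 p.2 := by
    simp only [Matrix.mul_apply, Matrix.of_apply]
    fun_prop
  have hprob := Measure.isProbabilityMeasure_map
    (μ := Measure.pi fun _ : Fin m × Fin n => stdComplexGaussian) hmeas.aemeasurable
  -- The Frobenius product of `h U` with `T` is that of `h` with `T U†`, and the characteristic
  -- function depends only on the Frobenius norm, which `U†` preserves.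
  refine charFun_eq_pi_iff.1 fun t => ?_
  set T : Matrix (Fin m) (Fin n) ℂ := Matrix.of fun k l => t.ofLp (k, l) with hT
  set T' : Matrix (Fin m) (Fin n) ℂ := T * (U : Matrix (Fin n) (Fin n) ℂ)ᴴ with hT'
  have hUU : (U : Matrix (Fin n) (Fin n) ℂ)ᴴ * U = 1 := by
    have := Unitary.coe_star_mul_self U
    rwa [Matrix.star_eq_conjTranspose] at this
  have hto : Measurable (WithLp.toLp 2 : (Fin m × Fin n → ℂ) → WithLp 2 (Fin m × Fin n → ℂ)) :=
    (MeasurableEquiv.toLp 2 _).measurable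
  rw [Measure.map_map hto hmeas]
  have h1 : charFun (Measure.map (WithLp.toLp 2 ∘ fun (h : Fin m × Fin n → ℂ) p =>
      (Matrix.of (fun k l => h (k, l)) * (U : Matrix (Fin n) (Fin n) ℂ)) p.1 p.2)
      (Measure.pi fun _ : Fin m × Fin n => stdComplexGaussian)) t
      = charFun (Measure.map (WithLp.toLp 2)
        (Measure.pi fun _ : Fin m × Fin n => stdComplexGaussian))
        (WithLp.toLp 2 fun p => T' p.1 p.2) := by
    rw [charFun_apply, charFun_apply, integral_map (hto.comp hmeas).aemeasurable (by fun_prop),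
      integral_map hto.aemeasurable (by fun_prop)]
    refine integral_congr_ae (ae_of_all _ fun h => ?_)
    simp only [Function.comp]
    congr 3
    rw [PiLp.inner_apply, PiLp.inner_apply]
    have e1 := sum_inner_eq_re_trace
      (Matrix.of (fun k l => h (k, l)) * (U : Matrix (Fin n) (Fin n) ℂ)) T
    have e2 := sum_inner_eq_re_trace (Matrix.of (fun k l => h (k, l))) T'
    rw [Matrix.conjTranspose_mul, ← Matrix.mul_assoc] at e1
    exact e1.trans e2.symm
  rw [h1, charFun_pi]
  simp_rw [charFun_stdComplexGaussian, ← Complex.exp_sum]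
  congr 1
  rw [Finset.sum_neg_distrib, Finset.sum_neg_distrib, ← Complex.ofReal_sum, ← Complex.ofReal_sum,
    ← Finset.sum_div, ← Finset.sum_div]
  congr 3
  have e1 := sum_inner_eq_re_trace T' T'
  have e2 := sum_inner_eq_re_trace T T
  simp_rw [real_inner_self_eq_norm_sq] at e1 e2
  have e3 : T' * T'ᴴ = T * Tᴴ := by
    rw [hT', Matrix.conjTranspose_mul, Matrix.conjTranspose_conjTranspose, Matrix.mul_assoc,
      ← Matrix.mul_assoc _ _ Tᴴ, hUU, Matrix.one_mul]
  rw [e3, ← e2] at e1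
  exact e1

end Unitary

/-- The squared modulus of a standard complex Gaussian is exponential. -/
lemma map_normSq_stdComplexGaussian :
    stdComplexGaussian.map (fun z => ‖z‖ ^ 2) = stdExp := by
  have hv : (1 / 2 : ℝ≥0) ≠ 0 := by norm_num
  refine Measure.ext_of_lintegral _ fun φ hφ => ?_
  have hm1 : Measurable fun z : ℂ => ‖z‖ ^ 2 := by fun_prop
  rw [lintegral_map hφ hm1, stdComplexGaussian,
    lintegral_map (f := fun z : ℂ => φ (‖z‖ ^ 2)) (hφ.comp hm1) measurable_complex_mk, gaussianReal_of_var_ne_zero _ hv,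
    prod_withDensity (measurable_gaussianPDF _ _) (measurable_gaussianPDF _ _),
    lintegral_withDensity_eq_lintegral_mul _
      (by have := measurable_gaussianPDF 0 (1 / 2); fun_prop)
      (g := fun p : ℝ × ℝ => φ (‖(⟨p.1, p.2⟩ : ℂ)‖ ^ 2))
      ((hφ.comp hm1).comp measurable_complex_mk)]
  have e1 : ∀ p : ℝ × ℝ, gaussianPDF 0 (1 / 2) p.1 * gaussianPDF 0 (1 / 2) p.2
      = ENNReal.ofReal (Real.pi⁻¹ * Real.exp (-(p.1 ^ 2 + p.2 ^ 2))) := fun p => by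
    rw [gaussianPDF, gaussianPDF, ← ENNReal.ofReal_mul (gaussianPDFReal_nonneg _ _ _),
      gaussianPDFReal_def]
    congr 1
    have hpi : √(2 * Real.pi * ((1 / 2 : ℝ≥0) : ℝ)) = √Real.pi := by
      congr 1; push_cast; ring
    simp only [hpi]
    have hs : (√Real.pi)⁻¹ * (√Real.pi)⁻¹ = Real.pi⁻¹ := by
      rw [← mul_inv, Real.mul_self_sqrt Real.pi_pos.le]
    rw [mul_mul_mul_comm, hs, ← Real.exp_add]
    congr 2
    push_cast
    ring
  have e2 : ∀ p : ℝ × ℝ, ‖(⟨p.1, p.2⟩ : ℂ)‖ ^ 2 = p.1 ^ 2 + p.2 ^ 2 := fun p => by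
    rw [← Complex.normSq_eq_norm_sq, Complex.normSq_apply]; ring
  simp only [Pi.mul_apply, e1, e2]
  rw [← Measure.volume_eq_prod, ← lintegral_comp_polarCoord_symm, stdExp, lintegral_densityMeasure (by fun_prop) hφ]
  have e3 : ∀ p : ℝ × ℝ, (polarCoord.symm p).1 ^ 2 + (polarCoord.symm p).2 ^ 2 = p.1 ^ 2 :=
    fun p => by
      simp only [polarCoord_symm_apply]
      linear_combination p.1 ^ 2 * Real.sin_sq_add_cos_sq p.2
  simp only [e3]
  rw [polarCoord_target, Measure.volume_eq_prod, ← Measure.prod_restrict,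
    lintegral_prod _ (by fun_prop)]
  -- After polar coordinates, the substitution `t = r ^ 2` turns the radial density `2 r exp (-r ^
  -- 2)` into `exp (-t)`.
  have himg : (fun r : ℝ => r ^ 2) '' Set.Ioi 0 = Set.Ioi 0 := by
    ext t
    constructor
    · rintro ⟨r, hr, rfl⟩
      exact pow_pos (Set.mem_Ioi.1 hr) 2
    · intro ht
      exact ⟨√t, Real.sqrt_pos.2 ht, Real.sq_sqrt (le_of_lt ht)⟩
  have hinj : Set.InjOn (fun r : ℝ => r ^ 2) (Set.Ioi 0) := fun x hx y hy h =>
    (pow_left_inj₀ (le_of_lt hx) (le_of_lt hy) two_ne_zero).1 h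
  conv_rhs => rw [← himg]
  rw [lintegral_image_eq_lintegral_abs_deriv_mul measurableSet_Ioi
    (f' := fun r => 2 * r) (fun r _ => by simpa using (hasDerivAt_pow 2 r).hasDerivWithinAt) hinj]
  refine setLIntegral_congr_fun measurableSet_Ioi fun r hr => ?_
  have hr : 0 < r := hr
  simp only [smul_eq_mul, lintegral_const, Measure.restrict_apply_univ, Real.volume_Ioo]
  rw [abs_of_pos (by positivity), ← mul_assoc, ← mul_assoc, mul_right_comm,
    ← ENNReal.ofReal_mul hr.le, ← ENNReal.ofReal_mul (by positivity),
    ← ENNReal.ofReal_mul (by positivity)]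
  congr 2
  have := Real.pi_pos.ne'
  field_simp
  ring

/-! ### Reduction to eigenvalues and bounds on the determinant. -/

section Spectral

variable {nt nr : ℕ}

lemma trace_unitary_conj_re (U : Matrix (Fin nt) (Fin nt) ℂ) (lam : Fin nt → ℝ)
    (H : Matrix (Fin nr) (Fin nt) ℂ) :
    (U * Matrix.diagonal (fun l => (lam l : ℂ)) * Uᴴ * (Hᴴ * H)).trace.re
      = ∑ p : Fin nr × Fin nt, lam p.2 * ‖(H * U) p.1 p.2‖ ^ 2 := by
  have e : (U * Matrix.diagonal (fun l => (lam l : ℂ)) * Uᴴ * (Hᴴ * H)).trace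
      = (Matrix.diagonal (fun l => (lam l : ℂ)) * ((H * U)ᴴ * (H * U))).trace := by
    rw [Matrix.mul_assoc, Matrix.mul_assoc, Matrix.trace_mul_comm, Matrix.conjTranspose_mul]
    simp only [Matrix.mul_assoc]
  rw [e, Matrix.trace, Complex.re_sum, Fintype.sum_prod_type_right]
  refine Finset.sum_congr rfl fun l _ => ?_
  rw [Matrix.diag_apply, Matrix.diagonal_mul, Complex.re_ofReal_mul, Matrix.mul_apply,
    Complex.re_sum, Finset.mul_sum]
  refine Finset.sum_congr rfl fun k _ => ?_
  rw [Matrix.conjTranspose_apply, ← Complex.normSq_eq_norm_sq]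
  congr 1
  simp [Complex.normSq_apply]

lemma exists_unitary_conj {Q : Matrix (Fin nt) (Fin nt) ℂ} (hQ : Q.PosSemidef) :
    ∃ (U : Matrix.unitaryGroup (Fin nt) ℂ) (lam : Fin nt → ℝ), (∀ l, 0 ≤ lam l) ∧
      ∑ l, lam l = Q.trace.re ∧
      Q = (U : Matrix (Fin nt) (Fin nt) ℂ) * Matrix.diagonal (fun l => (lam l : ℂ)) *
        (U : Matrix (Fin nt) (Fin nt) ℂ)ᴴ := by
  refine ⟨hQ.1.eigenvectorUnitary, hQ.1.eigenvalues, hQ.eigenvalues_nonneg, ?_, ?_⟩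
  · rw [hQ.1.trace_eq_sum_eigenvalues, Complex.re_sum]
    rfl
  · have := hQ.1.spectral_theorem
    rwa [Unitary.conjStarAlgAut_apply] at this

lemma det_one_add_eq_prod {n : ℕ} {A : Matrix (Fin n) (Fin n) ℂ} (hA : A.PosSemidef) :
    ∃ lam : Fin n → ℝ, (∀ l, 0 ≤ lam l) ∧ ∑ l, lam l = A.trace.re ∧
      (1 + A).det = ((∏ l, (1 + lam l) : ℝ) : ℂ) := by
  obtain ⟨U, lam, h0, htr, hAU⟩ := exists_unitary_conj hA
  refine ⟨lam, h0, htr, ?_⟩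
  have hU : (U : Matrix (Fin n) (Fin n) ℂ)ᴴ * U = 1 := Unitary.coe_star_mul_self U
  rw [hAU, Matrix.mul_assoc, Matrix.det_one_add_mul_comm, Matrix.mul_assoc, hU, Matrix.mul_one,
    ← Matrix.diagonal_one, Matrix.diagonal_add, Matrix.det_diagonal]
  push_cast
  rfl

lemma one_add_sum_le_prod {ι : Type*} (s : Finset ι) {x : ι → ℝ} (hx : ∀ i, 0 ≤ x i) :
    1 + ∑ i ∈ s, x i ≤ ∏ i ∈ s, (1 + x i) := by
  classical
  induction s using Finset.induction_on with
  | empty => simp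
  | insert i s hi ih =>
    rw [Finset.sum_insert hi, Finset.prod_insert hi]
    have h1 := mul_le_mul_of_nonneg_left ih (by linarith [hx i] : 0 ≤ 1 + x i)
    have h2 := mul_nonneg (hx i) (Finset.sum_nonneg fun j (_ : j ∈ s) => hx j)
    linarith

/-- `1 + tr A ≤ det (1 + A) ≤ exp (tr A)` for the matrix `A = Q H† H`. -/
lemma det_bounds {Q : Matrix (Fin nt) (Fin nt) ℂ} (hQ : Q.PosSemidef)
    (H : Matrix (Fin nr) (Fin nt) ℂ) :
    0 ≤ (Q * (Hᴴ * H)).trace.re ∧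
    1 + (Q * (Hᴴ * H)).trace.re ≤ (1 + Q * (Hᴴ * H)).det.re ∧
      (1 + Q * (Hᴴ * H)).det.re ≤ Real.exp (Q * (Hᴴ * H)).trace.re := by
  obtain ⟨U, lam, h0, -, hQU⟩ := exists_unitary_conj hQ
  -- Factor `Q = C C†`. Since `det (1 + A B) = det (1 + B A)`, the possibly non-Hermitian `Q H† H`
  -- may be replaced by the positive semidefinite `(H C)† (H C)`, of the same trace.
  set C : Matrix (Fin nt) (Fin nt) ℂ :=
    (U : Matrix (Fin nt) (Fin nt) ℂ) * Matrix.diagonal (fun l => ((√(lam l) : ℝ) : ℂ)) with hC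
  have hQC : Q = C * Cᴴ := by
    rw [hQU, hC, Matrix.conjTranspose_mul, Matrix.diagonal_conjTranspose,
      Matrix.mul_assoc (U : Matrix (Fin nt) (Fin nt) ℂ) (Matrix.diagonal _)
        (Matrix.diagonal _ * _), ← Matrix.mul_assoc (Matrix.diagonal _), Matrix.diagonal_mul_diagonal,
      Matrix.mul_assoc]
    congr 3
    funext l
    simp only [Pi.star_apply, RCLike.star_def, Complex.conj_ofReal, ← Complex.ofReal_mul,
      Real.mul_self_sqrt (h0 l)]
  have e1 : (1 + Q * (Hᴴ * H)).det = (1 + (H * C)ᴴ * (H * C)).det := by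
    rw [hQC, Matrix.mul_assoc, Matrix.det_one_add_mul_comm, Matrix.conjTranspose_mul H C]
    simp only [Matrix.mul_assoc]
  have e2 : (Q * (Hᴴ * H)).trace = ((H * C)ᴴ * (H * C)).trace := by
    rw [hQC, Matrix.mul_assoc, Matrix.trace_mul_comm, Matrix.conjTranspose_mul H C]
    simp only [Matrix.mul_assoc]
  obtain ⟨ev, hev, htr, hdet⟩ := det_one_add_eq_prod (Matrix.posSemidef_conjTranspose_mul_self (H * C))
  rw [e1, e2, hdet, ← htr, Complex.ofReal_re]
  refine ⟨Finset.sum_nonneg fun i _ => hev i, one_add_sum_le_prod _ hev, ?_⟩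
  rw [Real.exp_sum]
  refine Finset.prod_le_prod (fun i _ => by linarith [hev i]) fun i _ => ?_
  linarith [Real.add_one_le_exp (ev i)]

lemma lowSNRInfo_le_mutualInfo {Q : Matrix (Fin nt) (Fin nt) ℂ} (hQ : Q.PosSemidef)
    (H : Matrix (Fin nr) (Fin nt) ℂ) : lowSNRInfo Q H ≤ mutualInfo Q H := by
  obtain ⟨h0, h1, -⟩ := det_bounds hQ H
  exact Real.log_le_log (by linarith) h1

lemma mutualInfo_le_trace {Q : Matrix (Fin nt) (Fin nt) ℂ} (hQ : Q.PosSemidef)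
    (H : Matrix (Fin nr) (Fin nt) ℂ) : mutualInfo Q H ≤ (Q * (Hᴴ * H)).trace.re := by
  obtain ⟨h0, h1, h2⟩ := det_bounds hQ H
  exact (Real.log_le_iff_le_exp (by linarith)).2 h2

variable {Ω : Type*} [MeasurableSpace Ω] {μ : Measure Ω}
  {H : Ω → Matrix (Fin nr) (Fin nt) ℂ}

lemma IsRayleigh.map_eq_pi (hH : IsRayleigh μ H) :
    μ.map (fun ω (p : Fin nr × Fin nt) => H ω p.1 p.2)
      = Measure.pi fun _ => stdComplexGaussian := by
  refine (iIndepFun.map_fun_eq_pi_map (f := fun (p : Fin nr × Fin nt) ω => H ω p.1 p.2)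
    (fun p => (hH.hasLaw p.1 p.2).aemeasurable) hH.indep).trans ?_
  congr 1
  funext p
  exact (hH.hasLaw p.1 p.2).map_eq

/-- The law of `tr (Q H† H)` in terms of the eigenvalues of `Q`. -/
lemma IsRayleigh.real_le_trace (hH : IsRayleigh μ H) (U : Matrix.unitaryGroup (Fin nt) ℂ)
    (lam : Fin nt → ℝ) (x : ℝ) :
    μ.real {ω | x ≤ ((U : Matrix (Fin nt) (Fin nt) ℂ) * Matrix.diagonal (fun l => (lam l : ℂ)) *
        (U : Matrix (Fin nt) (Fin nt) ℂ)ᴴ * ((H ω)ᴴ * H ω)).trace.re}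
      = expTail (fun p : Fin nr × Fin nt => lam p.2) x := by
  have hmU : Measurable fun (h : Fin nr × Fin nt → ℂ) (p : Fin nr × Fin nt) =>
      (Matrix.of (fun k l => h (k, l)) * (U : Matrix (Fin nt) (Fin nt) ℂ)) p.1 p.2 := by
    simp only [Matrix.mul_apply, Matrix.of_apply]
    fun_prop
  have hmN : Measurable fun (h : Fin nr × Fin nt → ℂ) (p : Fin nr × Fin nt) => ‖h p‖ ^ 2 := by
    fun_prop
  have hpi : (Measure.pi fun _ : Fin nr × Fin nt => stdExp)
      = (Measure.pi fun _ : Fin nr × Fin nt => stdComplexGaussian).map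
        (fun h p => ‖h p‖ ^ 2) := by
    have : ∀ p : Fin nr × Fin nt, SigmaFinite
        (Measure.map (fun z : ℂ => ‖z‖ ^ 2) stdComplexGaussian) := fun p => by
      rw [map_normSq_stdComplexGaussian]; infer_instance
    rw [Measure.pi_map_pi (f := fun _ z => ‖z‖ ^ 2) fun p => by fun_prop]
    simp only [map_normSq_stdComplexGaussian]
  have hS : MeasurableSet {y : Fin nr × Fin nt → ℝ | x ≤ ∑ p, lam p.2 * y p} :=
    measurableSet_le measurable_const (by fun_prop)
  have hae : AEMeasurable (fun ω (p : Fin nr × Fin nt) => H ω p.1 p.2) μ :=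
    aemeasurable_pi_lambda _ fun p => (hH.hasLaw p.1 p.2).aemeasurable
  rw [expTail, measureReal_def, measureReal_def, hpi, Measure.map_apply hmN hS,
    ← map_mul_unitary_pi U, Measure.map_apply hmU (hmN hS), ← hH.map_eq_pi,
    Measure.map_apply_of_aemeasurable hae (hmU (hmN hS))]
  congr 2
  ext ω
  simp only [Set.mem_ofPred_eq, Set.mem_preimage, trace_unitary_conj_re]
  rfl

end Spectral

/-! ### Optimization over the normalized level. -/

section UniformTail

variable (ι : Type*) [Fintype ι]

/-- The tail of the mean of independent standard exponentials. -/
def uniformTail (s : ℝ) : ℝ := expTail (fun _ : ι => 1 / (Fintype.card ι : ℝ)) s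

variable [Nonempty ι]

lemma one_div_card_pos : (0 : ℝ) < 1 / (Fintype.card ι : ℝ) := by
  have : (0 : ℝ) < Fintype.card ι := by exact_mod_cast Fintype.card_pos
  positivity

lemma sum_one_div_card : ∑ _i : ι, 1 / (Fintype.card ι : ℝ) = 1 := by
  have : (Fintype.card ι : ℝ) ≠ 0 := by exact_mod_cast Fintype.card_ne_zero
  rw [Finset.sum_const, Finset.card_univ, nsmul_eq_mul]
  field_simp

lemma continuousOn_uniformTail : ContinuousOn (uniformTail ι) (Set.Icc 0 1) :=
  (continuousOn_expTail fun _ => one_div_card_pos ι).mono Set.Icc_subset_Ici_self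

lemma uniformTail_pos {s : ℝ} (hs : 0 ≤ s) : 0 < uniformTail ι s := by
  obtain ⟨f, hf, -, hint, htail⟩ := exists_expTail_density fun _ : ι => one_div_card_pos ι
  rw [uniformTail, htail s hs]
  have hpos : ∀ x ∈ Set.Ioi s, 0 < f x := fun x hx => hf.pos x (hs.trans_lt hx)
  rw [setIntegral_pos_iff_support_of_nonneg_ae]
  · have : Function.support f ∩ Set.Ioi s = Set.Ioi s :=
      Set.inter_eq_right.2 fun x hx => (hpos x hx).ne'
    rw [this]
    simp
  · filter_upwards [ae_restrict_mem measurableSet_Ioi] with x hx using (hpos x hx).le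
  · exact hint.mono_set (Set.Ioi_subset_Ioi hs)

variable {ι}

lemma mul_expTail_le_min {a : ι → ℝ} (ha : ∀ i, 0 ≤ a i) (hsum : ∑ i, a i ≤ 1) {s : ℝ}
    (hs : 0 < s) : s * expTail a s ≤ min s 1 * uniformTail ι (min s 1) := by
  rcases le_total s 1 with h | h
  · rw [min_eq_left h]
    exact mul_le_mul_of_nonneg_left (expTail_le_uniform ha hsum hs h) hs.le
  · rw [min_eq_right h, one_mul]
    exact mul_expTail_le_uniform ha hsum h

/-- By concavity and `log 1 = 0`, the quotient `log (1 + c s) / s` decreases. So levels above the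
mean reduce to level `1`, where `s P(W ≥ s)` is controlled. -/
lemma mul_log_one_add_le {c t s : ℝ} (hc : 0 < c) (ht : 0 < t) (hts : t ≤ s) :
    t * Real.log (1 + c * s) ≤ s * Real.log (1 + c * t) := by
  have hs : 0 < s := ht.trans_le hts
  have hconc := strictConcaveOn_log_Ioi.concaveOn.2
    (Set.mem_Ioi.2 (by positivity : 0 < 1 + c * s)) (Set.mem_Ioi.2 one_pos)
    (by positivity : 0 ≤ t / s) (sub_nonneg.2 ((div_le_one hs).2 hts)) (by ring)
  simp only [smul_eq_mul, Real.log_one, mul_zero, add_zero] at hconc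
  have e : t / s * (1 + c * s) + (1 - t / s) * 1 = 1 + c * t := by field_simp; ring
  rw [e] at hconc
  have := mul_le_mul_of_nonneg_left hconc hs.le
  have e2 : s * (t / s * Real.log (1 + c * s)) = t * Real.log (1 + c * s) := by field_simp
  rwa [e2] at this

lemma expTail_mul_log_le {a : ι → ℝ} (ha : ∀ i, 0 ≤ a i) (hsum : ∑ i, a i ≤ 1) {s c : ℝ}
    (hs : 0 < s) (hc : 0 < c) :
    expTail a s * Real.log (1 + c * s)
      ≤ uniformTail ι (min s 1) * Real.log (1 + c * min s 1) := by
  have ht : 0 < min s 1 := lt_min hs one_pos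
  set t := min s 1 with hteq
  have h1 := mul_expTail_le_min ha hsum hs
  rw [← hteq] at h1
  have h2 := mul_log_one_add_le hc ht (min_le_left s 1)
  have hl : 0 ≤ Real.log (1 + c * s) := Real.log_nonneg (by nlinarith)
  have hF : 0 < uniformTail ι t := uniformTail_pos ι ht.le
  have h3 := mul_le_mul_of_nonneg_right h1 hl
  have h4 := mul_le_mul_of_nonneg_left h2 hF.le
  have h5 : s * (expTail a s * Real.log (1 + c * s))
      ≤ s * (uniformTail ι t * Real.log (1 + c * t)) := by linarith
  exact le_of_mul_le_mul_left h5 hs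

variable (ι)

/-- The maximum over the open interval is attained. -/
lemma exists_max_uniformTail_mul_log {c : ℝ} (hc : 0 < c) :
    ∃ t₀ ∈ Set.Ioo (0 : ℝ) 1, ∀ t ∈ Set.Ioc (0 : ℝ) 1,
      uniformTail ι t * Real.log (1 + c * t) ≤ uniformTail ι t₀ * Real.log (1 + c * t₀) := by
  set k : ℝ → ℝ := fun t => uniformTail ι t * Real.log (1 + c * t) with hk
  have hkc : ContinuousOn k (Set.Icc 0 1) := by
    refine (continuousOn_uniformTail ι).mul (ContinuousOn.log (by fun_prop) fun t ht => ?_)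
    have := mul_nonneg hc.le ht.1
    positivity
  obtain ⟨t₀, ht₀, hmax⟩ := isCompact_Icc.exists_isMaxOn (Set.nonempty_Icc.2 zero_le_one) hkc
  have hmax' : ∀ t ∈ Set.Icc (0 : ℝ) 1, k t ≤ k t₀ := fun t ht => hmax ht
  refine ⟨t₀, ⟨?_, ?_⟩, fun t ht => hmax' t ⟨ht.1.le, ht.2⟩⟩
  · refine lt_of_le_of_ne ht₀.1 fun h => ?_
    have h1 := hmax' 1 ⟨zero_le_one, le_rfl⟩
    have h2 : 0 < k 1 := mul_pos (uniformTail_pos ι zero_le_one) (Real.log_pos (by linarith))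
    rw [← h] at h1
    simp only [hk, mul_zero, add_zero, Real.log_one] at h1 h2
    linarith
  -- At `1` the derivative is negative: the tail is at most the density `f 1` there, and `c / (1 +
  -- c) < log (1 + c)`. Points slightly to the left would do better.
  · refine lt_of_le_of_ne ht₀.2 fun h => ?_
    rw [h] at hmax'
    obtain ⟨f, hf⟩ := exists_hasDerivAt_expTail (fun _ : ι => one_div_card_pos ι)
      (sum_one_div_card ι)
    obtain ⟨hfpos, hfd, hfle⟩ := hf 1 le_rfl
    rw [one_mul] at hfle
    have hlog : HasDerivAt (fun t => Real.log (1 + c * t)) (c / (1 + c * 1)) 1 := by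
      have := ((hasDerivAt_id (1 : ℝ)).const_mul c).const_add 1
      simpa using this.log (by simp; positivity)
    have hkd : HasDerivAt k (-f 1 * Real.log (1 + c * 1)
        + uniformTail ι 1 * (c / (1 + c * 1))) 1 := HasDerivAt.mul hfd hlog
    have hstrict : c / (1 + c * 1) < Real.log (1 + c * 1) := by
      have h1 : 0 < (1 + c)⁻¹ := by positivity
      have h2 := Real.log_lt_sub_one_of_pos h1 (by
        intro h
        have := inv_eq_one.1 h
        linarith)
      rw [Real.log_inv] at h2
      have h3 : (1 + c)⁻¹ - 1 = -(c / (1 + c)) := by field_simp; ring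
      rw [mul_one]
      linarith
    have hneg : -f 1 * Real.log (1 + c * 1) + uniformTail ι 1 * (c / (1 + c * 1)) < 0 := by
      have h1 : uniformTail ι 1 * (c / (1 + c * 1)) ≤ f 1 * (c / (1 + c * 1)) :=
        mul_le_mul_of_nonneg_right hfle (by positivity)
      have h2 := mul_lt_mul_of_pos_left hstrict hfpos
      linarith
    have hev := (hkd.tendsto_slope_zero_left).eventually (gt_mem_nhds hneg)
    have hev2 : ∀ᶠ t in 𝓝[<] (0 : ℝ), -1 < t := nhdsWithin_le_nhds (lt_mem_nhds (by norm_num))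
    obtain ⟨t, h1, h2, h3⟩ := (hev.and (hev2.and self_mem_nhdsWithin)).exists
    have h3 : t < 0 := h3
    have h4 := hmax' (1 + t) ⟨by linarith, by linarith⟩
    have h5 : 0 ≤ t⁻¹ • (k (1 + t) - k 1) :=
      mul_nonneg_of_nonpos_of_nonpos (inv_nonpos.2 h3.le) (by linarith)
    linarith

/-- This is the objective linearized at small power; its maximum is the constant in the asymptotics,
so it is harmless if `t₁ = 1`. -/
lemma exists_max_mul_uniformTail : ∃ t₁ ∈ Set.Ioc (0 : ℝ) 1,
    ∀ t ∈ Set.Ioc (0 : ℝ) 1, t * uniformTail ι t ≤ t₁ * uniformTail ι t₁ := by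
  have hkc : ContinuousOn (fun t => t * uniformTail ι t) (Set.Icc 0 1) :=
    continuousOn_id.mul (continuousOn_uniformTail ι)
  obtain ⟨t₁, ht₁, hmax⟩ := isCompact_Icc.exists_isMaxOn (Set.nonempty_Icc.2 zero_le_one) hkc
  have hmax' : ∀ t ∈ Set.Icc (0 : ℝ) 1, t * uniformTail ι t ≤ t₁ * uniformTail ι t₁ :=
    fun t ht => hmax ht
  refine ⟨t₁, ⟨lt_of_le_of_ne ht₁.1 fun h => ?_, ht₁.2⟩, fun t ht => hmax' t ⟨ht.1.le, ht.2⟩⟩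
  have h1 := hmax' 1 ⟨zero_le_one, le_rfl⟩
  rw [← h, zero_mul, one_mul] at h1
  linarith [uniformTail_pos ι zero_le_one]

end UniformTail

/-! ### From tails to throughputs. -/

section Throughput

variable {nt nr : ℕ}

lemma rateFormula_eq (hnt : 0 < nt) (hnr : 0 < nr) (P : ℝ) {t : ℝ} (ht : 0 ≤ t) :
    rateFormula nt nr P (nr * t)
      = uniformTail (Fin nr × Fin nt) t * Real.log (1 + P * nr * t) := by
  have : Nonempty (Fin nr × Fin nt) := ⟨(⟨0, hnr⟩, ⟨0, hnt⟩)⟩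
  rw [uniformTail, expTail_uniform_eq ht, rateFormula, Fintype.card_prod, Fintype.card_fin,
    Fintype.card_fin, mul_comm nr nt]
  push_cast
  ring_nf

lemma equalPower_mem_admissible (hnt : 0 < nt) {P : ℝ} (hP : 0 ≤ P) :
    equalPower nt P ∈ admissible nt P := by
  have hn : (0 : ℝ) < nt := by exact_mod_cast hnt
  refine ⟨Matrix.PosSemidef.one.smul ?_, ?_⟩
  · exact_mod_cast div_nonneg hP hn.le
  · rw [equalPower, Matrix.trace_smul, Matrix.trace_one, Fintype.card_fin, smul_eq_mul,
      Complex.re_ofReal_mul, Complex.natCast_re, div_mul_cancel₀ _ hn.ne']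

variable {Ω : Type*} [MeasurableSpace Ω] {μ : Measure Ω}
  {H : Ω → Matrix (Fin nr) (Fin nt) ℂ}

/-- The unit `P * nr` is the largest mean of the trace: each eigenvalue of `Q` weights `nr`
exponentials, and the eigenvalues sum to at most `P`. -/
lemma IsRayleigh.exists_weights (hH : IsRayleigh μ H) (hnr : 0 < nr) {P : ℝ} (hP : 0 < P)
    {Q : Matrix (Fin nt) (Fin nt) ℂ} (hQ : Q ∈ admissible nt P) :
    ∃ a : Fin nr × Fin nt → ℝ, (∀ i, 0 ≤ a i) ∧ ∑ i, a i ≤ 1 ∧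
      ∀ s, μ.real {ω | P * nr * s ≤ (Q * ((H ω)ᴴ * H ω)).trace.re} = expTail a s := by
  obtain ⟨U, lam, h0, htr, hQU⟩ := exists_unitary_conj hQ.1
  have hn : (0 : ℝ) < nr := by exact_mod_cast hnr
  have hPn : 0 < P * nr := mul_pos hP hn
  refine ⟨fun p => lam p.2 / (P * nr), fun p => div_nonneg (h0 _) hPn.le, ?_, fun s => ?_⟩
  · rw [Fintype.sum_prod_type]
    simp only [Finset.sum_const, Finset.card_univ, Fintype.card_fin, nsmul_eq_mul]
    rw [← Finset.sum_div, htr, ← mul_div_assoc, div_le_one hPn, mul_comm]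
    exact mul_le_mul_of_nonneg_right hQ.2 hn.le
  · rw [hQU, hH.real_le_trace U lam,
      ← expTail_const_mul hPn (fun p : Fin nr × Fin nt => lam p.2 / (P * nr)) s]
    congr 1
    funext p
    field_simp

lemma IsRayleigh.real_le_trace_equalPower (hH : IsRayleigh μ H) (hnt : 0 < nt) (hnr : 0 < nr)
    {P : ℝ} (hP : 0 < P) (s : ℝ) :
    μ.real {ω | P * nr * s ≤ (equalPower nt P * ((H ω)ᴴ * H ω)).trace.re}
      = uniformTail (Fin nr × Fin nt) s := by
  have hn : (0 : ℝ) < nr := by exact_mod_cast hnr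
  have hm : (0 : ℝ) < nt := by exact_mod_cast hnt
  have hQ : equalPower nt P = ((1 : Matrix.unitaryGroup (Fin nt) ℂ) : Matrix (Fin nt) (Fin nt) ℂ)
      * Matrix.diagonal (fun _ => ((P / nt : ℝ) : ℂ))
      * ((1 : Matrix.unitaryGroup (Fin nt) ℂ) : Matrix (Fin nt) (Fin nt) ℂ)ᴴ := by
    simp [equalPower, Matrix.smul_one_eq_diagonal]
  rw [hQ, hH.real_le_trace 1 (fun _ => P / nt), uniformTail,
    ← expTail_const_mul (mul_pos hP hn) (fun _ => 1 / (Fintype.card (Fin nr × Fin nt) : ℝ)) s]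
  congr 1
  funext p
  rw [Fintype.card_prod, Fintype.card_fin, Fintype.card_fin]
  push_cast
  field_simp

lemma le_lowSNRInfo_iff {Q : Matrix (Fin nt) (Fin nt) ℂ} (hQ : Q.PosSemidef)
    (H : Matrix (Fin nr) (Fin nt) ℂ) {x : ℝ} (hx : 0 < 1 + x) :
    Real.log (1 + x) ≤ lowSNRInfo Q H ↔ x ≤ (Q * (Hᴴ * H)).trace.re := by
  have := (det_bounds hQ H).1
  rw [lowSNRInfo, Real.log_le_log_iff hx (by linarith)]
  exact add_le_add_iff_left 1

lemma IsRayleigh.throughput_lowSNRInfo_equalPower (hH : IsRayleigh μ H) (hnt : 0 < nt)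
    (hnr : 0 < nr) {P t : ℝ} (hP : 0 < P) (ht : 0 ≤ t) :
    throughput lowSNRInfo μ H (equalPower nt P) (Real.log (1 + P * nr * t))
      = uniformTail (Fin nr × Fin nt) t * Real.log (1 + P * nr * t) := by
  rw [throughput, ← hH.real_le_trace_equalPower hnt hnr hP]
  simp only [le_lowSNRInfo_iff (equalPower_mem_admissible hnt hP.le).1 _
    (by positivity : 0 < 1 + P * nr * t)]

lemma throughput_nonpos (info : Matrix (Fin nt) (Fin nt) ℂ → Matrix (Fin nr) (Fin nt) ℂ → ℝ)
    (Q : Matrix (Fin nt) (Fin nt) ℂ) {R : ℝ} (hR : R ≤ 0) : throughput info μ H Q R ≤ 0 :=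
  mul_nonpos_of_nonneg_of_nonpos measureReal_nonneg hR

lemma IsRayleigh.throughput_lowSNRInfo_le (hH : IsRayleigh μ H) (hnt : 0 < nt) (hnr : 0 < nr)
    {P R : ℝ} (hP : 0 < P) (hR : 0 < R) {Q : Matrix (Fin nt) (Fin nt) ℂ}
    (hQ : Q ∈ admissible nt P) :
    ∃ t ∈ Set.Ioc (0 : ℝ) 1, throughput lowSNRInfo μ H Q R
      ≤ uniformTail (Fin nr × Fin nt) t * Real.log (1 + P * nr * t) := by
  have : Nonempty (Fin nr × Fin nt) := ⟨(⟨0, hnr⟩, ⟨0, hnt⟩)⟩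
  obtain ⟨a, ha, hsum, hlaw⟩ := hH.exists_weights hnr hP hQ
  have hPn : 0 < P * nr := mul_pos hP (by exact_mod_cast hnr)
  set s := (Real.exp R - 1) / (P * nr) with hs
  have hs0 : 0 < s := div_pos (by linarith [Real.add_one_lt_exp hR.ne']) hPn
  have hx : P * nr * s = Real.exp R - 1 := by rw [hs]; field_simp
  have hlog : R = Real.log (1 + P * nr * s) := by rw [hx]; simp
  refine ⟨min s 1, ⟨lt_min hs0 one_pos, min_le_right _ _⟩, ?_⟩
  refine le_trans (le_of_eq ?_) (expTail_mul_log_le ha hsum hs0 hPn)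
  rw [throughput, ← hlaw s, hlog]
  simp only [le_lowSNRInfo_iff hQ.1 _ (by positivity : 0 < 1 + P * nr * s)]

lemma IsRayleigh.throughput_mutualInfo_le [IsFiniteMeasure μ] (hH : IsRayleigh μ H) (hnt : 0 < nt) (hnr : 0 < nr)
    {P R t₁ : ℝ} (hP : 0 < P) (ht₁ : 0 ≤ t₁) {Q : Matrix (Fin nt) (Fin nt) ℂ}
    (hQ : Q ∈ admissible nt P) (hmax : ∀ t ∈ Set.Ioc (0 : ℝ) 1,
      t * uniformTail (Fin nr × Fin nt) t ≤ t₁ * uniformTail (Fin nr × Fin nt) t₁) :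
    throughput mutualInfo μ H Q R ≤ P * nr * (t₁ * uniformTail (Fin nr × Fin nt) t₁) := by
  have : Nonempty (Fin nr × Fin nt) := ⟨(⟨0, hnr⟩, ⟨0, hnt⟩)⟩
  have hPn : 0 < P * nr := mul_pos hP (by exact_mod_cast hnr)
  rcases le_or_gt R 0 with hR | hR
  · refine (throughput_nonpos _ _ hR).trans ?_
    have := uniformTail_pos (Fin nr × Fin nt) ht₁
    positivity
  obtain ⟨a, ha, hsum, hlaw⟩ := hH.exists_weights hnr hP hQ
  set s := R / (P * nr) with hs
  have hs0 : 0 < s := div_pos hR hPn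
  have hx : P * nr * s = R := by rw [hs]; field_simp
  -- Bounding the mutual information by the trace makes the rate linear in the level, whence `s = R
  -- / (P * nr)` instead of the logarithmic relation.
  have h1 : μ.real {ω | R ≤ mutualInfo Q (H ω)} ≤ expTail a s := by
    rw [← hlaw s, hx]
    exact measureReal_mono fun ω (hω : R ≤ _) => hω.trans (mutualInfo_le_trace hQ.1 _)
  calc throughput mutualInfo μ H Q R ≤ expTail a s * R := mul_le_mul_of_nonneg_right h1 hR.le
    _ = P * nr * (s * expTail a s) := by rw [← hx]; ring
    _ ≤ _ := mul_le_mul_of_nonneg_left ((mul_expTail_le_min ha hsum hs0).trans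
      (hmax _ ⟨lt_min hs0 one_pos, min_le_right _ _⟩)) hPn.le

lemma throughputsAt_subset {info : Matrix (Fin nt) (Fin nt) ℂ → Matrix (Fin nr) (Fin nt) ℂ → ℝ}
    {P : ℝ} {Q : Matrix (Fin nt) (Fin nt) ℂ} (hQ : Q ∈ admissible nt P) :
    throughputsAt info μ H Q ⊆ throughputs info μ H P := by
  rintro _ ⟨R, rfl⟩
  exact ⟨Q, hQ, R, rfl⟩

end Throughput

lemma tendsto_log_one_add_div {c : ℝ} (hc : 0 < c) :
    Tendsto (fun P : ℝ => Real.log (1 + P * c) / (P * c)) (𝓝[>] 0) (𝓝 1) := by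
  have hd : HasDerivAt (fun P : ℝ => Real.log (1 + P * c)) c 0 := by
    have := ((hasDerivAt_id (0 : ℝ)).mul_const c).const_add 1
    simpa using this.log (by simp)
  have h := (hd.tendsto_slope_zero_right).div_const c
  rw [div_self hc.ne'] at h
  refine h.congr fun P => ?_
  simp
  rw [mul_comm P⁻¹, mul_div_assoc, div_eq_mul_inv, div_eq_mul_inv, mul_inv]

end MIMO

end

theorem mainTheorem7 {nt nr : ℕ} (hnt : 0 < nt) (hnr : 0 < nr)
    {Ω : Type*} [MeasurableSpace Ω] (μ : Measure Ω) [IsProbabilityMeasure μ]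
    (H : Ω → Matrix (Fin nr) (Fin nt) ℂ) (hH : MIMO.IsRayleigh μ H) :
    ∃ Rmax : ℝ → ℝ,
      -- the low-SNR form of the mutual information, every power `P`
      (∀ P : ℝ, 0 < P →
        IsGreatest (MIMO.rateFormula nt nr P '' Set.Ioo 0 (nr : ℝ)) (Rmax P) ∧
        IsGreatest (MIMO.throughputs MIMO.lowSNRInfo μ H P) (Rmax P) ∧
        MIMO.equalPower nt P ∈ MIMO.admissible nt P ∧
        IsGreatest (MIMO.throughputsAt MIMO.lowSNRInfo μ H (MIMO.equalPower nt P)) (Rmax P)) ∧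
      -- the exact mutual information, asymptotically as `P → 0`
      (∀ P : ℝ, 0 < P → BddAbove (MIMO.throughputs MIMO.mutualInfo μ H P)) ∧
      (fun P : ℝ => sSup (MIMO.throughputs MIMO.mutualInfo μ H P)) ~[𝓝[>] 0] Rmax ∧
      (fun P : ℝ => sSup (MIMO.throughputsAt MIMO.mutualInfo μ H (MIMO.equalPower nt P)))
        ~[𝓝[>] 0] (fun P : ℝ => sSup (MIMO.throughputs MIMO.mutualInfo μ H P)) := by
  have : Nonempty (Fin nr × Fin nt) := ⟨(⟨0, hnr⟩, ⟨0, hnt⟩)⟩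
  have hn : (0 : ℝ) < nr := by exact_mod_cast hnr
  set F := MIMO.uniformTail (Fin nr × Fin nt) with hF
  -- The condition `0 < P` sits under the existential so that `choose` gives a function of `P`
  -- alone; its values at `P ≤ 0` play no role.
  have hmaxex : ∀ P : ℝ, ∃ t₀ : ℝ, 0 < P → t₀ ∈ Set.Ioo (0 : ℝ) 1 ∧ ∀ t ∈ Set.Ioc (0 : ℝ) 1,
      F t * Real.log (1 + P * nr * t) ≤ F t₀ * Real.log (1 + P * nr * t₀) := fun P => by
    by_cases hP : 0 < P
    · obtain ⟨t₀, h, h'⟩ := MIMO.exists_max_uniformTail_mul_log (Fin nr × Fin nt)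
        (mul_pos hP hn)
      exact ⟨t₀, fun _ => ⟨h, h'⟩⟩
    · exact ⟨0, fun h => absurd h hP⟩
  choose t₀ ht₀ using hmaxex
  set Rmax : ℝ → ℝ := fun P => F (t₀ P) * Real.log (1 + P * nr * t₀ P) with hRmax
  obtain ⟨t₁, ht₁, hmax₁⟩ := MIMO.exists_max_mul_uniformTail (Fin nr × Fin nt)
  have hFpos : 0 < F t₁ := MIMO.uniformTail_pos _ ht₁.1.le
  set A : ℝ → ℝ := fun P => P * nr * (t₁ * F t₁) with hA
  have hRpos : ∀ P, 0 < P → 0 ≤ Rmax P := fun P hP => by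
    have h1 := (ht₀ P hP).1.1
    exact mul_nonneg (MIMO.uniformTail_pos _ h1.le).le
      (Real.log_nonneg (by have : 0 < P * nr * t₀ P := by positivity
                           linarith))
  have hadm : ∀ P, 0 < P → MIMO.equalPower nt P ∈ MIMO.admissible nt P := fun P hP =>
    MIMO.equalPower_mem_admissible hnt hP.le
  have hupper : ∀ P, 0 < P → A P ∈ upperBounds (MIMO.throughputs MIMO.mutualInfo μ H P) := by
    rintro P hP _ ⟨Q, hQ, R, rfl⟩
    exact hH.throughput_mutualInfo_le hnt hnr hP ht₁.1.le hQ hmax₁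
  have hbdd : ∀ P, 0 < P → BddAbove (MIMO.throughputs MIMO.mutualInfo μ H P) := fun P hP =>
    ⟨A P, hupper P hP⟩
  have hsub : ∀ P, 0 < P → MIMO.throughputsAt MIMO.mutualInfo μ H (MIMO.equalPower nt P)
      ⊆ MIMO.throughputs MIMO.mutualInfo μ H P := fun P hP => MIMO.throughputsAt_subset (hadm P hP)
  have hne : ∀ P, (MIMO.throughputsAt MIMO.mutualInfo μ H (MIMO.equalPower nt P)).Nonempty :=
    fun P => Set.range_nonempty _
  have hSA : ∀ P, 0 < P → sSup (MIMO.throughputs MIMO.mutualInfo μ H P) ≤ A P := fun P hP =>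
    csSup_le ((hne P).mono (hsub P hP)) (hupper P hP)
  have hES : ∀ P, 0 < P → sSup (MIMO.throughputsAt MIMO.mutualInfo μ H (MIMO.equalPower nt P))
      ≤ sSup (MIMO.throughputs MIMO.mutualInfo μ H P) := fun P hP =>
    csSup_le_csSup (hbdd P hP) (hne P) (hsub P hP)
  have hRE : ∀ P, 0 < P → Rmax P
      ≤ sSup (MIMO.throughputsAt MIMO.mutualInfo μ H (MIMO.equalPower nt P)) := fun P hP => by
    have h1 := (ht₀ P hP).1.1
    have hR0 : 0 ≤ Real.log (1 + P * nr * t₀ P) :=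
      Real.log_nonneg (by have : 0 < P * nr * t₀ P := by positivity
                          linarith)
    refine le_csSup_of_le ((hbdd P hP).mono (hsub P hP)) ⟨Real.log (1 + P * nr * t₀ P), rfl⟩ ?_
    simp only [hRmax, hF]
    rw [← hH.throughput_lowSNRInfo_equalPower hnt hnr hP h1.le]
    exact mul_le_mul_of_nonneg_right (measureReal_mono fun ω (hω : _ ≤ _) =>
      hω.trans (MIMO.lowSNRInfo_le_mutualInfo (hadm P hP).1 _)) hR0
  -- Testing at the fixed level `t₁`, independent of `P`, gives a lower bound with the same leading
  -- term as `A P`.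
  have hLR : ∀ P, 0 < P → F t₁ * Real.log (1 + P * (nr * t₁)) ≤ Rmax P := fun P hP => by
    rw [← mul_assoc]
    exact (ht₀ P hP).2 t₁ ht₁
  have hc : 0 < nr * t₁ := mul_pos hn ht₁.1
  have hApos : ∀ P, 0 < P → 0 < A P := fun P hP => by
    have := ht₁.1
    simp only [hA]; positivity
  -- The ratio of `u` to `A` lies between `log (1 + P nr t₁) / (P nr t₁)` and `1`. This applies to
  -- both suprema and to `Rmax`, so all three are equivalent to `A`.
  have hsqueeze : ∀ u : ℝ → ℝ, (∀ P, 0 < P → Rmax P ≤ u P) → (∀ P, 0 < P → u P ≤ A P) →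
      u ~[𝓝[>] 0] A := fun u h1 h2 => by
    have hpos : ∀ᶠ P : ℝ in 𝓝[>] 0, 0 < P := self_mem_nhdsWithin
    rw [Asymptotics.isEquivalent_iff_tendsto_one (hpos.mono fun P hP => (hApos P hP).ne')]
    refine tendsto_of_tendsto_of_tendsto_of_le_of_le' (MIMO.tendsto_log_one_add_div hc)
      tendsto_const_nhds ?_ ?_
    · filter_upwards [hpos] with P hP
      rw [Pi.div_apply, div_le_div_iff₀ (mul_pos hP hc) (hApos P hP)]
      have h3 := (hLR P hP).trans (h1 P hP)
      have h4 := mul_le_mul_of_nonneg_right h3 (mul_pos hP hc).le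
      have e : Real.log (1 + P * (nr * t₁)) * A P
          = F t₁ * Real.log (1 + P * (nr * t₁)) * (P * (nr * t₁)) := by simp only [hA]; ring
      rw [e]
      exact h4
    · filter_upwards [hpos] with P hP
      exact (div_le_one (hApos P hP)).2 (h2 P hP)
  have eS := hsqueeze _ (fun P hP => (hRE P hP).trans (hES P hP)) hSA
  have eE := hsqueeze _ hRE (fun P hP => (hES P hP).trans (hSA P hP))
  have eR := hsqueeze Rmax (fun P _ => le_rfl) fun P hP =>
    ((hRE P hP).trans (hES P hP)).trans (hSA P hP)
  refine ⟨Rmax, fun P hP => ?_, hbdd, eS.trans eR.symm, eE.trans eS.symm⟩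
  obtain ⟨⟨h0, h1⟩, hmax⟩ := ht₀ P hP
  have hupperLow : Rmax P ∈ upperBounds (MIMO.throughputs MIMO.lowSNRInfo μ H P) := by
    rintro _ ⟨Q, hQ, R, rfl⟩
    rcases le_or_gt R 0 with hR | hR
    · exact (MIMO.throughput_nonpos _ _ hR).trans (hRpos P hP)
    · obtain ⟨t, ht, hle⟩ := hH.throughput_lowSNRInfo_le hnt hnr hP hR hQ
      exact hle.trans (hmax t ht)
  have hmem : Rmax P ∈ MIMO.throughputsAt MIMO.lowSNRInfo μ H (MIMO.equalPower nt P) :=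
    ⟨Real.log (1 + P * nr * t₀ P), hH.throughput_lowSNRInfo_equalPower hnt hnr hP h0.le⟩
  refine ⟨⟨?_, ?_⟩, ⟨MIMO.throughputsAt_subset (hadm P hP) hmem, hupperLow⟩, hadm P hP, hmem,
    fun x hx => hupperLow (MIMO.throughputsAt_subset (hadm P hP) hx)⟩
  · refine ⟨nr * t₀ P, ⟨by positivity, ?_⟩, MIMO.rateFormula_eq hnt hnr P h0.le⟩
    exact (mul_lt_mul_of_pos_left h1 hn).trans_eq (mul_one _)
  · rintro _ ⟨s, hs, rfl⟩
    have ht : 0 < s / nr := div_pos hs.1 hn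
    have e : s = nr * (s / nr) := by field_simp
    rw [e, MIMO.rateFormula_eq hnt hnr P ht.le]
    exact hmax _ ⟨ht, (div_le_one hn).2 hs.2.le⟩
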